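/- Let $\zeta:\mathcal A\to\mathcal A^+$ be a substitution on $\mathcal A=\{1,\dots,m\}$ whose substitution matrix $\mathsf S$, with $\mathsf S(i,j)$ = number of symbols $i$ in $\zeta(j)$, is primitive. Let $\theta=\theta_1,\theta_2,\dots,\theta_m$ be the eigenvalues of $\mathsf S$, counted with algebraic multiplicity and ordered by non-increasing modulus. Suppose that $m\ge 2$ and $|\theta_2|>1$, and that exactly $\alpha+1$ of the eigenvalues $\theta_1,\dots,\theta_m$ (counted with algebraic multiplicity) have modulus $|\theta_2|$. Put $\beta=\log_\theta|\theta_2|$. Let $X_\zeta\subset\mathcal A^{\mathbb Z}$ be the substitution space (all $x$ such that each block $x[-n,n]$ is a subword of some $\zeta^k(a)$), $T$ the left shift on $X_\zeta$, and $\mu$ its (unique) invariant Borel probability measure. For $\vec s=(s_1,\dots,s_m)$ with all $s_a>0$ and $\sum_a s_a=1$, let $\mathfrak X=\{(x,t): x\in X_\zeta,\ 0\le t\le s_{x_0}\}$, with $(x,s_{x_0})$ identified with $(Tx,0)$, let $h_t$ be the suspension flow (vertical translation) on $\mathfrak X$, and let $\widetilde\mu$ be its invariant probability measure, i.e. the normalized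 restriction of $\mu\times\mathrm{Leb}$ to $\mathfrak X$. A cylindrical function is a function $f(x,t)=\psi_{x_0}(t)$, $0\le t<s_{x_0}$, with Lipschitz functions $\psi_a:[0,s_a]\to\mathbb C$, $a\in\mathcal A$; put $\|f\|_\infty=\max_a\sup_{[0,s_a]}|\psi_a|$. Its spectral measure $\sigma_f$ is the finite positive Borel measure on $\mathbb R$ with $$\int_{\mathbb R}e^{2\pi i\omega t}\,d\sigma_f(\omega)=\int_{\mathfrak X}(f\circ h_t)\,\overline f\,d\widetilde\mu\qquad\text{for all }t\in\mathbb R.$$ Then for every such $\vec s$ there is a constant $C$, depending only on $\zeta$ and $\vec s$, such that for every cylindrical function $f$ with $\int f\,d\widetilde\mu=0$, $$\sigma_f([-r,r])\le C\,\|f\|_\infty^2\,\bigl(\log(1/r)\bigr)^{2\alpha}\,r^{2-2\beta}\qquad\text{for all }0<r\le\tfrac12 .$$ -/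

import Mathlib

open MeasureTheory

noncomputable section

namespace SubstFlow

/-- A substitution on the alphabet `Fin m`: every letter is sent to a nonempty word. -/
structure Substitution (m : ℕ) where
  word : Fin m → List (Fin m)
  word_ne_nil : ∀ a, word a ≠ []

namespace Substitution

variable {m : ℕ} (ζ : Substitution m)

/-- The extension of `ζ` to words by concatenation. -/
def apply (w : List (Fin m)) : List (Fin m) := w.flatMap ζ.word

/-- The word `ζ^k(a)`. -/
def iter (k : ℕ) (a : Fin m) : List (Fin m) := ζ.apply^[k] [a]

/-- The substitution matrix: the entry `(i, j)` is the number of symbols `i` in `ζ(j)`. -/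
def matrix : Matrix (Fin m) (Fin m) ℕ := Matrix.of fun i j => (ζ.word j).count i

/-- `ζ` is primitive: some power of the substitution matrix has only positive entries. -/
def IsPrimitive : Prop := (ζ.matrix.map (Nat.cast : ℕ → ℝ)).IsPrimitive

/-- `L` lists all the complex eigenvalues of the substitution matrix, each one repeated
according to its algebraic multiplicity, in the order of non-increasing modulus. -/
def IsEigenvalueList (L : List ℂ) : Prop :=
  (L : Multiset ℂ) = (ζ.matrix.map (Nat.cast : ℕ → ℂ)).charpoly.roots ∧
    L.Pairwise fun z w => ‖w‖ ≤ ‖z‖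

end Substitution

/-- The block `x_i x_{i+1} … x_{i+n-1}` of a two-sided sequence. -/
def block {m : ℕ} (x : ℤ → Fin m) (i : ℤ) (n : ℕ) : List (Fin m) :=
  (List.range n).map fun k : ℕ => x (i + k)

/-- The substitution space: all two-sided sequences `x` such that every block `x[-n,n]` is a
subword of some `ζ^k(a)`. It carries the Borel (product) sigma-algebra of `ℤ → Fin m`. -/
def Space {m : ℕ} (ζ : Substitution m) : Set (ℤ → Fin m) :=
  {x | ∀ n : ℕ, ∃ (k : ℕ) (a : Fin m), block x (-n) (2 * n + 1) <:+: ζ.iter k a}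

theorem block_infix {m : ℕ} (x : ℤ → Fin m) (i : ℤ) (p n q : ℕ) :
    block x (i + p) n <:+: block x i (p + n + q) := by
  refine ⟨block x i p, block x (i + p + n) q, ?_⟩
  simp only [block, List.range_add, List.map_append, List.map_map]
  congr 2
  · apply List.map_congr_left
    intro k _
    simp [add_assoc]
  · funext k
    simp [add_assoc]

theorem shift_mem {m : ℕ} (ζ : Substitution m) (n : ℤ) {x : ℤ → Fin m} (hx : x ∈ Space ζ) :
    (fun j => x (j + n)) ∈ Space ζ := by
  intro N
  obtain ⟨k, a, h⟩ := hx (N + n.natAbs)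
  refine ⟨k, a, List.IsInfix.trans ?_ h⟩
  obtain ⟨p, hp⟩ : ∃ p : ℕ, (p : ℤ) = n.natAbs + n := ⟨(n.natAbs + n).toNat, by omega⟩
  obtain ⟨q, hq⟩ : ∃ q : ℕ, (q : ℤ) = n.natAbs - n := ⟨(n.natAbs - n).toNat, by omega⟩
  have h1 : block (fun j => x (j + n)) (-N) (2 * N + 1)
      = block x (-((N + n.natAbs : ℕ) : ℤ) + p) (2 * N + 1) := by
    apply List.map_congr_left
    intro k _
    have : (-(N : ℤ) + k + n) = -((N + n.natAbs : ℕ) : ℤ) + p + k := by omega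
    simp only [this]
  have h2 : 2 * (N + n.natAbs) + 1 = p + (2 * N + 1) + q := by omega
  rw [h1, h2]
  exact block_infix x _ p _ q

/-- The `n`-th power (`n ∈ ℤ`) of the left shift, on the substitution space. -/
def shift {m : ℕ} (ζ : Substitution m) (n : ℤ) (x : Space ζ) : Space ζ :=
  ⟨fun j => x.1 (j + n), shift_mem ζ n x.2⟩

/-- The simplex of roof vectors: strictly positive vectors with sum one. -/
def roofSimplex (m : ℕ) : Set (Fin m → ℝ) := {s | (∀ a, 0 < s a) ∧ ∑ a, s a = 1}

/-- The height at which the `n`-th letter of `x` starts: `s_{x_0} + … + s_{x_{n-1}}` for `n ≥ 0`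
and `-(s_{x_n} + … + s_{x_{-1}})` for `n < 0`. -/
def roofSum {m : ℕ} (s : Fin m → ℝ) (x : ℤ → Fin m) (n : ℤ) : ℝ :=
  ∑ j ∈ Finset.Ico 0 n, s (x j) - ∑ j ∈ Finset.Ico n 0, s (x j)

theorem roofSum_succ {m : ℕ} (s : Fin m → ℝ) (x : ℤ → Fin m) (n : ℤ) :
    roofSum s x (n + 1) = roofSum s x n + s (x n) := by
  unfold roofSum
  rcases le_or_gt 0 n with h | h
  · have e : Finset.Ico 0 (n + 1) = insert n (Finset.Ico 0 n) := by
      ext j; simp only [Finset.mem_Ico, Finset.mem_insert]; omega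
    rw [e, Finset.sum_insert (by simp), Finset.Ico_eq_empty_of_le h,
      Finset.Ico_eq_empty_of_le (by omega : (0 : ℤ) ≤ n + 1)]
    simp [add_comm]
  · have e : Finset.Ico n 0 = insert n (Finset.Ico (n + 1) 0) := by
      ext j; simp only [Finset.mem_Ico, Finset.mem_insert]; omega
    rw [e, Finset.sum_insert (by simp), Finset.Ico_eq_empty_of_le h.le,
      Finset.Ico_eq_empty_of_le (by omega : n + 1 ≤ (0 : ℤ))]
    simp

theorem exists_roofIndex {m : ℕ} {s : Fin m → ℝ} (hs : ∀ a, 0 < s a) (x : ℤ → Fin m) (u : ℝ) :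
    ∃ n : ℤ, roofSum s x n ≤ u ∧ u < roofSum s x (n + 1) := by
  obtain ⟨a₀, -, h₀⟩ := Finset.exists_min_image Finset.univ s ⟨x 0, Finset.mem_univ _⟩
  set c := s a₀ with hc
  have hcpos : 0 < c := hs a₀
  have hmin : ∀ a, c ≤ s a := fun a => h₀ a (Finset.mem_univ a)
  have hup : ∀ k : ℕ, (k : ℝ) * c ≤ roofSum s x k := by
    intro k
    induction k with
    | zero => simp [roofSum]
    | succ k ih =>
      push_cast
      rw [roofSum_succ]
      nlinarith [hmin (x k)]
  have hdn : ∀ k : ℕ, roofSum s x (-k) ≤ -((k : ℝ) * c) := by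
    intro k
    induction k with
    | zero => simp [roofSum]
    | succ k ih =>
      have := roofSum_succ s x (-((k + 1 : ℕ) : ℤ))
      rw [show (-((k + 1 : ℕ) : ℤ) + 1) = -(k : ℤ) by push_cast; ring] at this
      push_cast at this ⊢
      nlinarith [hmin (x (-(k + 1 : ℤ)))]
  have hmono : Monotone (roofSum s x) :=
    monotone_int_of_le_succ fun n => by rw [roofSum_succ]; linarith [hs (x n)]
  obtain ⟨k, hk⟩ := exists_nat_gt (|u| / c)
  rw [div_lt_iff₀ hcpos] at hk
  obtain ⟨n, hn, hmax⟩ := Int.exists_greatest_of_bdd (P := fun n => roofSum s x n ≤ u)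
    ⟨k, fun z hz => by
      by_contra! hlt
      have := hmono hlt.le
      linarith [hup k, le_abs_self u]⟩
    ⟨-k, by linarith [hdn k, neg_abs_le u]⟩
  refine ⟨n, hn, ?_⟩
  by_contra! h
  have := hmax (n + 1) h
  omega

/-- The index of the letter of `x` over which the height `u` lies. -/
def roofIndex {m : ℕ} {s : Fin m → ℝ} (hs : ∀ a, 0 < s a) (x : ℤ → Fin m) (u : ℝ) : ℤ :=
  (exists_roofIndex hs x u).choose

theorem roofIndex_spec {m : ℕ} {s : Fin m → ℝ} (hs : ∀ a, 0 < s a) (x : ℤ → Fin m) (u : ℝ) :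
    roofSum s x (roofIndex hs x u) ≤ u ∧ u < roofSum s x (roofIndex hs x u + 1) :=
  (exists_roofIndex hs x u).choose_spec

/-- The points of the suspension: pairs `(x, t)` with `x` in the substitution space and
`0 ≤ t < s_{x_0}` (the top `(x, s_{x_0})` is identified with `(T x, 0)`). -/
def suspension {m : ℕ} (ζ : Substitution m) (s : Fin m → ℝ) : Set (Space ζ × ℝ) :=
  {p | 0 ≤ p.2 ∧ p.2 < s (p.1.1 0)}

/-- The suspension flow: move up with unit speed. From `(x, t)` one reaches at time `τ` the
height `t + τ`, which lies over the `n`-th letter of `x`, that is, the point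
`(T^n x, t + τ - roofSum s x n)`. -/
def flow {m : ℕ} (ζ : Substitution m) {s : Fin m → ℝ} (hs : ∀ a, 0 < s a) (τ : ℝ)
    (y : suspension ζ s) : suspension ζ s :=
  ⟨(shift ζ (roofIndex hs y.1.1.1 (y.1.2 + τ)) y.1.1,
      y.1.2 + τ - roofSum s y.1.1.1 (roofIndex hs y.1.1.1 (y.1.2 + τ))), by
    have h := roofIndex_spec hs y.1.1.1 (y.1.2 + τ)
    rw [roofSum_succ] at h
    refine ⟨by simpa using h.1, ?_⟩
    simp only [shift, zero_add]
    linarith [h.2]⟩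

/-- The restriction of `μ × Lebesgue` to the suspension. -/
def suspMeasure₀ {m : ℕ} (ζ : Substitution m) (s : Fin m → ℝ) (μ : Measure (Space ζ)) :
    Measure (suspension ζ s) :=
  (μ.prod volume).comap Subtype.val

/-- The invariant probability measure of the suspension flow induced by `μ`: the restriction of
`μ × Lebesgue` to the suspension, normalized. -/
def suspMeasure {m : ℕ} (ζ : Substitution m) (s : Fin m → ℝ) (μ : Measure (Space ζ)) :
    Measure (suspension ζ s) :=
  (suspMeasure₀ ζ s μ Set.univ)⁻¹ • suspMeasure₀ ζ s μ

/-- The cylindrical function `f(x, t) = ψ_{x_0}(t)` on the suspension. -/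
def cylindrical {m : ℕ} (ζ : Substitution m) (s : Fin m → ℝ) (ψ : Fin m → ℝ → ℂ) :
    suspension ζ s → ℂ :=
  fun y => ψ (y.1.1.1 0) y.1.2

/-- `σ` is the spectral measure of `f` for the flow `h` and the invariant measure `ν`: the finite
Borel measure on the line with `∫ e^{2πiωt} dσ(ω) = ⟨f ∘ h_t, f⟩` for all real `t`. -/
def IsSpectralMeasure {Y : Type*} [MeasurableSpace Y] (ν : Measure Y) (h : ℝ → Y → Y) (f : Y → ℂ)
    (σ : Measure ℝ) : Prop :=
  IsFiniteMeasure σ ∧ ∀ t : ℝ,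
    ∫ ω : ℝ, Complex.exp (2 * Real.pi * Complex.I * ω * t) ∂σ
      = ∫ y, f (h t y) * (starRingEnd ℂ) (f y) ∂ν

end SubstFlow

end

/-!
The sum of a letter function `v` over the word `ζ^n(a)` is the `a`-th entry of `v Sⁿ`, where `S` is
the substitution matrix. On the hyperplane orthogonal to the Perron eigenvector `y` of `S`, the
matrix `S` agrees with its deflation `S - θ y lᵀ`, whose eigenvalues are `0, θ₂, …, θ_m`; since
`α + 1` of them have the maximal modulus `|θ₂|`, there `v Sⁿ` is `O(n^α |θ₂|ⁿ)`. Desubstituting a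
word of length at most `N` about `log_θ N` times, which costs boundedly many letters at either end
each time, bounds the sum of `v` over it by `O((log N)^α N^β)`. As `β < 1`, such a `v` has mean zero
for every invariant probability measure, and so conversely mean zero implies orthogonality to `y`.

An orbit segment of the suspension flow reads off a word of the language, up to two incomplete
letters, so the integrals of a mean-zero cylindrical function `f` over orbit segments of length `R`
are `O(‖f‖_∞ (log R)^α R^β)`. By the definition of `σ_f`, the mean square of these integrals is
`∫ |∫_0^R e^{2πiωt} dt|² dσ_f(ω)`, which for `R = 1 / (2πr)` is at least
`(R / 2)² σ_f([-r, r])` because the real part of the integrand is then at least `1 / 2`.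
-/

open Filter Topology Polynomial Matrix

namespace SubstFlow

section PowerGrowth

variable {𝕜 E 𝔸 : Type*} [NormedField 𝕜] [SeminormedAddCommGroup E] [NormedSpace 𝕜 E]
  [NormedRing 𝔸] [NormedAlgebra 𝕜 𝔸]

lemma norm_le_of_norm_succ_sub_smul_le_of_norm_lt {u : ℕ → E} {z : 𝕜} {R C : ℝ} {j : ℕ}
    (hz : ‖z‖ < R) (hu : ∀ n : ℕ, ‖u (n + 1) - z • u n‖ ≤ C * (n + 1) ^ j * R ^ n) (n : ℕ) :
    ‖u n‖ ≤ max ‖u 0‖ (C / (R - ‖z‖)) * (n + 1) ^ j * R ^ n := by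
  set K := max ‖u 0‖ (C / (R - ‖z‖))
  have hR : 0 < R := (norm_nonneg z).trans_lt hz
  have : 0 ≤ K := (norm_nonneg _).trans (le_max_left _ _)
  have hC : C ≤ K * (R - ‖z‖) := (div_le_iff₀ (sub_pos.2 hz)).1 (le_max_right _ _)
  induction n with
  | zero => simp [K]
  | succ n ih =>
    calc ‖u (n + 1)‖ ≤ ‖u (n + 1) - z • u n‖ + ‖z‖ * ‖u n‖ := by
          simpa [norm_smul] using norm_add_le (u (n + 1) - z • u n) (z • u n)
      _ ≤ K * (R - ‖z‖) * (n + 1) ^ j * R ^ n + ‖z‖ * (K * (n + 1) ^ j * R ^ n) := by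
          gcongr
          exact (hu n).trans (by gcongr)
      _ = K * (n + 1) ^ j * R ^ (n + 1) := by ring
      _ ≤ K * ((n + 1 : ℕ) + 1) ^ j * R ^ (n + 1) := by gcongr; simp

lemma norm_le_of_norm_succ_sub_smul_le_of_norm_le {u : ℕ → E} {z : 𝕜} {R C : ℝ} {j : ℕ}
    (hR : 0 < R) (hz : ‖z‖ ≤ R)
    (hu : ∀ n : ℕ, ‖u (n + 1) - z • u n‖ ≤ C * (n + 1) ^ j * R ^ n) (n : ℕ) :
    ‖u n‖ ≤ max ‖u 0‖ (C / R) * (n + 1) ^ (j + 1) * R ^ n := by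
  set K := max ‖u 0‖ (C / R)
  have : 0 ≤ K := (norm_nonneg _).trans (le_max_left _ _)
  have hC : C ≤ K * R := (div_le_iff₀ hR).1 (le_max_right _ _)
  induction n with
  | zero => simp [K]
  | succ n ih =>
    calc ‖u (n + 1)‖ ≤ ‖u (n + 1) - z • u n‖ + ‖z‖ * ‖u n‖ := by
          simpa [norm_smul] using norm_add_le (u (n + 1) - z • u n) (z • u n)
      _ ≤ K * R * (n + 1) ^ j * R ^ n + R * (K * (n + 1) ^ (j + 1) * R ^ n) := by
          gcongr
          exact (hu n).trans (by gcongr)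
      _ = K * ((n + 1 : ℕ) + 1) * (n + 1) ^ j * R ^ (n + 1) := by push_cast; ring
      _ ≤ K * ((n + 1 : ℕ) + 1) * ((n + 1 : ℕ) + 1) ^ j * R ^ (n + 1) := by gcongr; simp
      _ = K * ((n + 1 : ℕ) + 1) ^ (j + 1) * R ^ (n + 1) := by ring

lemma aeval_X_sub_C_mul_pow_mul (a : 𝔸) (z : 𝕜) (p : 𝕜[X]) (n : ℕ) :
    a ^ n * aeval a ((X - C z) * p) = a ^ (n + 1) * aeval a p - z • (a ^ n * aeval a p) := by
  rw [map_mul, map_sub, aeval_X, aeval_C, Algebra.algebraMap_eq_smul_one, sub_mul, mul_sub,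
    smul_mul_assoc, one_mul, mul_smul_comm, pow_succ, mul_assoc]

lemma exists_norm_pow_le_of_norm_pow_mul_aeval_prod_le {R : ℝ} (hR : 0 < R) (a : 𝔸)
    {s : Multiset 𝕜} (hs : ∀ z ∈ s, ‖z‖ ≤ R) {K : ℝ} {j : ℕ}
    (h : ∀ n : ℕ, ‖a ^ n * aeval a (s.map fun z => X - C z).prod‖ ≤ K * (n + 1) ^ j * R ^ n) :
    ∃ K', ∀ n : ℕ, ‖a ^ n‖ ≤ K' * (n + 1) ^ (j + s.countP (‖·‖ = R)) * R ^ n := by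
  induction s using Multiset.induction_on generalizing K j with
  | empty => exact ⟨K, by simpa using h⟩
  | cons z s ih =>
    have hs' : ∀ w ∈ s, ‖w‖ ≤ R := fun w hw => hs w (Multiset.mem_cons_of_mem hw)
    simp only [Multiset.map_cons, Multiset.prod_cons, aeval_X_sub_C_mul_pow_mul] at h
    rcases (hs z (Multiset.mem_cons_self z s)).lt_or_eq with hz | hz
    · rw [Multiset.countP_cons_of_neg (p := fun y => ‖y‖ = R) s hz.ne]
      exact ih hs' (norm_le_of_norm_succ_sub_smul_le_of_norm_lt hz h)
    · rw [Multiset.countP_cons_of_pos (p := fun y => ‖y‖ = R) s hz, add_comm _ 1, ← add_assoc]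
      exact ih hs' (norm_le_of_norm_succ_sub_smul_le_of_norm_le hR hz.le h)

theorem exists_norm_pow_le_of_aeval_prod_eq_zero {R : ℝ} (hR : 0 < R) {a : 𝔸} {s : Multiset 𝕜}
    (hs : ∀ z ∈ s, ‖z‖ ≤ R) {d : ℕ} (hd : s.countP (‖·‖ = R) = d + 1)
    (ha : aeval a (s.map fun z => X - C z).prod = 0) :
    ∃ K, ∀ n : ℕ, ‖a ^ n‖ ≤ K * (n + 1) ^ d * R ^ n := by
  obtain ⟨z, hzs, hz⟩ : ∃ z ∈ s, ‖z‖ = R := Multiset.countP_pos.1 (by omega)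
  obtain ⟨s, rfl⟩ := Multiset.exists_cons_of_mem hzs
  rw [Multiset.countP_cons_of_pos (p := fun y => ‖y‖ = R) s hz, add_left_inj] at hd
  simp only [Multiset.map_cons, Multiset.prod_cons] at ha
  set w := aeval a (s.map fun z => X - C z).prod
  have hpow : ∀ n, a ^ n * w = z ^ n • w := by
    intro n
    induction n with
    | zero => simp
    | succ n ih =>
      have h := aeval_X_sub_C_mul_pow_mul a z (s.map fun z => X - C z).prod n
      rw [ha, mul_zero, eq_comm, sub_eq_zero] at h
      rw [h, ih, smul_smul, pow_succ']
  have hbound : ∀ n : ℕ, ‖a ^ n * w‖ ≤ ‖w‖ * (n + 1) ^ 0 * R ^ n := fun n => by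
    rw [hpow, norm_smul, norm_pow, hz, pow_zero, mul_one, mul_comm]
  simpa [hd] using exists_norm_pow_le_of_norm_pow_mul_aeval_prod_le hR a
    (fun y hy => hs y (Multiset.mem_cons_of_mem hy)) hbound

end PowerGrowth

section Perron

variable {ι : Type*} [Fintype ι] [DecidableEq ι]

lemma pow_mulVec_eq_smul {R : Type*} [CommSemiring R] {A : Matrix ι ι R} {y : ι → R} {ρ : R}
    (hy : A *ᵥ y = ρ • y) (n : ℕ) : (A ^ n) *ᵥ y = ρ ^ n • y := by
  induction n with
  | zero => simp
  | succ n ih => rw [pow_succ, ← mulVec_mulVec, hy, mulVec_smul, ih, smul_smul, pow_succ']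

/-- The identity `M ((X - ρ) - y wᵀ) = (X - ρ) (M - y wᵀ)` for `M = X - A`, which holds because
`M y = (X - ρ) y`, gives the claim on taking determinants. -/
lemma X_sub_C_mul_charpoly_add_vecMulVec {R : Type*} [CommRing R] {A : Matrix ι ι R} {y : ι → R}
    {ρ : R} (hy : A *ᵥ y = ρ • y) (w : ι → R) :
    (X - C ρ) * (A + vecMulVec y w).charpoly = (X - C (ρ + y ⬝ᵥ w)) * A.charpoly := by
  nontriviality R
  rcases isEmpty_or_nonempty ι with hι | hι
  · simp
  set N := vecMulVec y w with hN
  have hAN : charmatrix A * N.map C = (X - C ρ) • N.map C := by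
    have hy' : A * N = ρ • N := by rw [hN, mul_vecMulVec, hy, smul_vecMulVec]
    rw [charmatrix, sub_mul, RingHom.mapMatrix_apply, ← Matrix.map_mul, hy', sub_smul]
    ext i j
    simp
  have hmat : charmatrix A * charmatrix (N - scalar ι (-ρ)) = (X - C ρ) • charmatrix (A + N) := by
    have hshift : charmatrix (N - scalar ι (-ρ)) = (X - C ρ) • 1 - N.map C := by
      ext i j
      by_cases hij : i = j
      · simp [charmatrix, hij, sub_sub, add_comm]
      · simp [charmatrix, hij]
    have hadd : charmatrix (A + N) = charmatrix A - N.map C := by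
      simp only [charmatrix, map_add, RingHom.mapMatrix_apply, sub_sub]
    rw [hshift, hadd, mul_sub, hAN, smul_sub, mul_smul_comm, mul_one]
  have hdet := congrArg Matrix.det hmat
  rw [det_mul, det_smul] at hdet
  change A.charpoly * (N - scalar ι (-ρ)).charpoly = (X - C ρ) ^ _ * (A + N).charpoly at hdet
  obtain ⟨n, hn⟩ := Nat.exists_eq_succ_of_ne_zero (Fintype.card_ne_zero (α := ι))
  rw [charpoly_sub_scalar, charpoly_vecMulVec, hn] at hdet
  refine ((monic_X_sub_C ρ).pow n).isRegular.left ?_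
  simp only [sub_comp, pow_comp, mul_comp, C_comp, X_comp, C_neg, ← sub_eq_add_neg, smul_eq_C_mul,
    Nat.succ_sub_one, Nat.succ_eq_add_one, C_add] at hdet ⊢
  linear_combination -hdet

omit [DecidableEq ι] in
lemma mulVec_pos_of_forall_pos {P : Matrix ι ι ℝ} (hP : ∀ i j, 0 < P i j) {x : ι → ℝ}
    (hx : 0 ≤ x) (hx0 : x ≠ 0) (i : ι) : 0 < (P *ᵥ x) i := by
  obtain ⟨j, hj⟩ := Function.ne_iff.1 hx0
  exact Finset.sum_pos' (fun k _ => mul_nonneg (hP i k).le (hx k))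
    ⟨j, Finset.mem_univ j, mul_pos (hP i j) ((hx j).lt_of_ne' hj)⟩

omit [DecidableEq ι] in
lemma ne_zero_of_mem_stdSimplex {x : ι → ℝ} (hx : x ∈ stdSimplex ℝ ι) : x ≠ 0 := by
  rintro rfl
  simpa using hx.2

/-- The Collatz–Wielandt set of a matrix `B`: the pairs `(t, x)` of a number `t ≥ 0` and a
probability vector `x` with `t x ≤ B x`. The largest such `t` is the Perron root of `B`. -/
def collatzWielandtSet (B : Matrix ι ι ℝ) : Set (ℝ × (ι → ℝ)) :=
  {p | 0 ≤ p.1 ∧ p.2 ∈ stdSimplex ℝ ι ∧ p.1 • p.2 ≤ B *ᵥ p.2}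

omit [DecidableEq ι] in
lemma isCompact_collatzWielandtSet {B : Matrix ι ι ℝ} (hB : ∀ i j, 0 ≤ B i j) :
    IsCompact (collatzWielandtSet B) := by
  refine ((isCompact_Icc (a := 0) (b := ∑ i, ∑ j, B i j)).prod
    (isCompact_stdSimplex ℝ ι)).of_isClosed_subset ?_ fun p ⟨h0, hp, hle⟩ => ⟨⟨h0, ?_⟩, hp⟩
  · exact (isClosed_le continuous_const continuous_fst).inter
      (((isClosed_stdSimplex ℝ ι).preimage continuous_snd).inter
        (isClosed_le (continuous_fst.smul continuous_snd)
          (continuous_const.matrix_mulVec continuous_snd)))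
  · have hp1 : ∀ j, p.2 j ≤ 1 := fun j => (mem_Icc_of_mem_stdSimplex hp j).2
    calc p.1 = ∑ i, (p.1 • p.2) i := by
          simp only [Pi.smul_apply, smul_eq_mul, ← Finset.mul_sum, hp.2, mul_one]
      _ ≤ ∑ i, ∑ j, B i j * p.2 j := Finset.sum_le_sum fun i _ => hle i
      _ ≤ ∑ i, ∑ j, B i j := by
          gcongr with i _ j _
          exact mul_le_of_le_one_right (hB i j) (hp1 j)

lemma exists_lt_mem_collatzWielandtSet {B : Matrix ι ι ℝ} {k : ℕ} (hk : ∀ i j, 0 < (B ^ k) i j)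
    {t : ℝ} {x : ι → ℝ} (hx : (t, x) ∈ collatzWielandtSet B) (hne : B *ᵥ x ≠ t • x) :
    ∃ p ∈ collatzWielandtSet B, t < p.1 := by
  obtain ⟨ht, hxs, hle⟩ := hx
  set w := (B ^ k) *ᵥ x
  have hw : ∀ i, 0 < w i := mulVec_pos_of_forall_pos hk hxs.1 (ne_zero_of_mem_stdSimplex hxs)
  have hgap : ∀ i, 0 < (B *ᵥ w) i - t * w i := by
    have hcomm : B *ᵥ w - t • w = (B ^ k) *ᵥ (B *ᵥ x - t • x) := by
      rw [mulVec_sub, mulVec_smul, mulVec_mulVec, mulVec_mulVec, ← pow_succ, ← pow_succ']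
    intro i
    have h := mulVec_pos_of_forall_pos hk (sub_nonneg.2 hle) (sub_ne_zero.2 hne) i
    rwa [← hcomm] at h
  obtain ⟨δ, hδw, hδ⟩ : ∃ δ : ℝ, (∀ i, δ * w i < (B *ᵥ w) i - t * w i) ∧ 0 < δ := by
    have hsmall : ∀ i, ∀ᶠ δ : ℝ in 𝓝[>] 0, δ * w i < (B *ᵥ w) i - t * w i := fun i =>
      (((continuous_mul_const (w i)).tendsto' 0 0 (zero_mul _)).eventually
        (gt_mem_nhds (hgap i))).filter_mono nhdsWithin_le_nhds
    exact ((eventually_all.2 hsmall).and self_mem_nhdsWithin).exists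
  obtain ⟨i₀⟩ : Nonempty ι := by
    by_contra h
    exact hne (funext fun i => (h ⟨i⟩).elim)
  have hW : 0 < ∑ i, w i := Finset.sum_pos (fun i _ => hw i) ⟨i₀, Finset.mem_univ i₀⟩
  refine ⟨(t + δ, (∑ i, w i)⁻¹ • w), ⟨by positivity, ⟨fun i => ?_, ?_⟩, fun i => ?_⟩, by simpa⟩
  · exact mul_nonneg (inv_nonneg.2 hW.le) (hw i).le
  · simp only [Pi.smul_apply, smul_eq_mul, ← Finset.mul_sum, inv_mul_cancel₀ hW.ne']
  · have := mul_le_mul_of_nonneg_left (hδw i).le (inv_nonneg.2 hW.le)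
    simp only [mulVec_smul, Pi.smul_apply, smul_eq_mul]
    linarith

theorem exists_pos_mulVec_eq_smul [Nonempty ι] {B : Matrix ι ι ℝ} (hB : B.IsPrimitive) :
    ∃ ρ : ℝ, 0 < ρ ∧ ∃ y : ι → ℝ, (∀ i, 0 < y i) ∧ B *ᵥ y = ρ • y := by
  obtain ⟨hB0, k, hk0, hk⟩ := hB
  have hne : (collatzWielandtSet B).Nonempty := by
    obtain ⟨x, hx⟩ : (stdSimplex ℝ ι).Nonempty :=
      ⟨_, single_mem_stdSimplex ℝ (Classical.arbitrary ι)⟩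
    exact ⟨(0, x), le_rfl, hx, by
      rw [zero_smul]; exact fun i => Finset.sum_nonneg fun j _ => mul_nonneg (hB0 i j) (hx.1 j)⟩
  obtain ⟨⟨ρ, y⟩, hmem, hmax⟩ :=
    (isCompact_collatzWielandtSet hB0).exists_isMaxOn hne continuous_fst.continuousOn
  have heig : B *ᵥ y = ρ • y := by
    by_contra hne
    obtain ⟨p, hp, hlt⟩ := exists_lt_mem_collatzWielandtSet hk hmem hne
    exact (hmax hp).not_gt hlt
  have hpow : ∀ i, 0 < ρ ^ k * y i := fun i => by
    have h := mulVec_pos_of_forall_pos hk hmem.2.1.1 (ne_zero_of_mem_stdSimplex hmem.2.1) i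
    rwa [pow_mulVec_eq_smul heig] at h
  have hy : ∀ i, 0 < y i := fun i =>
    pos_of_mul_pos_right (hpow i) (pow_nonneg hmem.1 k)
  have hρ : ρ ≠ 0 := by
    rintro rfl
    simpa [hk0.ne'] using hpow (Classical.arbitrary ι)
  exact ⟨ρ, hmem.1.lt_of_ne' hρ, y, hy, heig⟩

omit [DecidableEq ι] in
/-- Doeblin's argument: on the hyperplane `l x = 0` the matrix `P` acts as `P - ε 1 lᵀ`, which for
small `ε` is still nonnegative and contracts the `l`-weighted `ℓ¹` norm by `r - ε ∑ l`. -/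
lemma norm_lt_of_map_mulVec_eq_smul {P : Matrix ι ι ℝ} (hP : ∀ i j, 0 < P i j) {l : ι → ℝ}
    (hl : ∀ i, 0 < l i) {r : ℝ} (hlP : l ᵥ* P = r • l) {z : ℂ} {x : ι → ℂ} (hx : x ≠ 0)
    (hPx : P.map ((↑) : ℝ → ℂ) *ᵥ x = z • x) (hlx : ∑ j, (l j : ℂ) * x j = 0) : ‖z‖ < r := by
  obtain ⟨i₀, hi₀⟩ := Function.ne_iff.1 hx
  obtain ⟨ε, hεP, hε⟩ : ∃ ε : ℝ, (∀ i j, ε * l j < P i j) ∧ 0 < ε := by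
    have hsmall : ∀ i j, ∀ᶠ ε : ℝ in 𝓝[>] 0, ε * l j < P i j := fun i j =>
      (((continuous_mul_const (l j)).tendsto' 0 0 (zero_mul _)).eventually
        (gt_mem_nhds (hP i j))).filter_mono nhdsWithin_le_nhds
    exact ((eventually_all.2 fun i => eventually_all.2 (hsmall i)).and self_mem_nhdsWithin).exists
  set N := ∑ j, l j * ‖x j‖
  have hN : 0 < N := Finset.sum_pos' (fun j _ => mul_nonneg (hl j).le (norm_nonneg _))
    ⟨i₀, Finset.mem_univ i₀, mul_pos (hl i₀) (norm_pos_iff.2 hi₀)⟩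
  have hsum : 0 < ∑ i, l i := Finset.sum_pos (fun i _ => hl i) ⟨i₀, Finset.mem_univ i₀⟩
  have hrow : ∀ i, ‖z‖ * ‖x i‖ ≤ ∑ j, (P i j - ε * l j) * ‖x j‖ := fun i => by
    have hzx : z * x i = ∑ j, ((P i j - ε * l j : ℝ) : ℂ) * x j := by
      calc z * x i = ∑ j, (P i j : ℂ) * x j - ε * ∑ j, (l j : ℂ) * x j := by
            rw [hlx, mul_zero, sub_zero]; exact (congrFun hPx i).symm
        _ = _ := by
            rw [Finset.mul_sum, ← Finset.sum_sub_distrib]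
            exact Finset.sum_congr rfl fun j _ => by push_cast; ring
    rw [← norm_mul, hzx]
    refine norm_sum_le_of_le _ fun j _ => ?_
    rw [norm_mul, Complex.norm_of_nonneg (sub_nonneg.2 (hεP i j).le)]
  have hcol : ∑ i, l i * ∑ j, P i j * ‖x j‖ = r * N := by
    have h := dotProduct_mulVec l P fun j => ‖x j‖
    rwa [hlP, smul_dotProduct] at h
  have hcontr : ‖z‖ * N ≤ (r - ε * ∑ i, l i) * N :=
    calc ‖z‖ * N = ∑ i, l i * (‖z‖ * ‖x i‖) := by
          rw [Finset.mul_sum]; exact Finset.sum_congr rfl fun i _ => by ring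
      _ ≤ ∑ i, l i * ∑ j, (P i j - ε * l j) * ‖x j‖ := by
          gcongr with i; exacts [(hl i).le, hrow i]
      _ = ∑ i, l i * ∑ j, P i j * ‖x j‖ - (ε * ∑ i, l i) * N := by
          simp only [sub_mul, Finset.sum_sub_distrib, mul_sub, mul_assoc, ← Finset.mul_sum,
            ← Finset.sum_mul, mul_left_comm _ ε, N]
      _ = (r - ε * ∑ i, l i) * N := by rw [hcol, sub_mul]
  have := le_of_mul_le_mul_right hcontr hN
  linarith [mul_pos hε hsum]

lemma isPrimitive_transpose {B : Matrix ι ι ℝ} (hB : B.IsPrimitive) : Bᵀ.IsPrimitive := by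
  obtain ⟨hB0, k, hk0, hk⟩ := hB
  exact ⟨fun i j => hB0 j i, k, hk0, fun i j => by simpa [← transpose_pow] using hk j i⟩

lemma exists_perron_eigenvectors [Nonempty ι] {B : Matrix ι ι ℝ} (hB : B.IsPrimitive) :
    ∃ ρ : ℝ, 0 < ρ ∧ ∃ y l : ι → ℝ, (∀ i, 0 < y i) ∧ (∀ i, 0 < l i) ∧
      B *ᵥ y = ρ • y ∧ l ᵥ* B = ρ • l ∧ l ⬝ᵥ y = 1 := by
  obtain ⟨ρ, hρ, y, hy, hBy⟩ := exists_pos_mulVec_eq_smul hB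
  obtain ⟨ρ', -, l, hl, hBl⟩ := exists_pos_mulVec_eq_smul (isPrimitive_transpose hB)
  rw [mulVec_transpose] at hBl
  have hly : 0 < l ⬝ᵥ y :=
    Finset.sum_pos (fun i _ => mul_pos (hl i) (hy i)) Finset.univ_nonempty
  have hρρ' : ρ' = ρ := by
    have h := dotProduct_mulVec l B y
    rw [hBy, hBl, dotProduct_smul, smul_dotProduct] at h
    exact (mul_right_cancel₀ hly.ne' h).symm
  refine ⟨ρ, hρ, y, (l ⬝ᵥ y)⁻¹ • l, hy, fun i => mul_pos (inv_pos.2 hly) (hl i), hBy, ?_, ?_⟩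
  · rw [smul_vecMul, hBl, hρρ', smul_comm]
  · rw [smul_dotProduct, smul_eq_mul, inv_mul_cancel₀ hly.ne']

lemma norm_eigenvalue_lt_of_isPrimitive {B : Matrix ι ι ℝ} (hB : B.IsPrimitive) {ρ : ℝ}
    (hρ : 0 < ρ) {l : ι → ℝ} (hl : ∀ i, 0 < l i) (hlB : l ᵥ* B = ρ • l) {z : ℂ} {x : ι → ℂ}
    (hx : x ≠ 0) (hBx : B.map ((↑) : ℝ → ℂ) *ᵥ x = z • x) (hlx : ∑ j, (l j : ℂ) * x j = 0) :
    ‖z‖ < ρ := by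
  obtain ⟨-, k, -, hk⟩ := hB
  have hlk : l ᵥ* B ^ k = ρ ^ k • l := by
    rw [← mulVec_transpose, transpose_pow]
    exact pow_mulVec_eq_smul (by rwa [mulVec_transpose]) k
  have hxk : (B ^ k).map ((↑) : ℝ → ℂ) *ᵥ x = z ^ k • x := by
    have hmap : (B ^ k).map ((↑) : ℝ → ℂ) = B.map ((↑) : ℝ → ℂ) ^ k :=
      map_pow Complex.ofRealHom.mapMatrix B k
    rw [hmap, pow_mulVec_eq_smul hBx]
  have h := norm_lt_of_map_mulVec_eq_smul hk hl hlk hx hxk hlx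
  rw [norm_pow] at h
  exact lt_of_pow_lt_pow_left₀ k hρ.le h

section Deflation

variable {R : Type*} [CommRing R] {A : Matrix ι ι R} {ρ : R} {y l : ι → R}

/-- The deflation `A - ρ y lᵀ` of a matrix `A`: if `y` and `l` are right and left eigenvectors of
`A` for the eigenvalue `ρ` with `l y = 1`, it has the eigenvalues of `A`, except that one copy of
`ρ` is replaced by `0`. -/
def deflation (A : Matrix ι ι R) (ρ : R) (y l : ι → R) : Matrix ι ι R :=
  A + vecMulVec y (-ρ • l)

omit [DecidableEq ι] in
lemma deflation_mulVec_of_dotProduct_eq_zero {x : ι → R} (hx : l ⬝ᵥ x = 0) :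
    deflation A ρ y l *ᵥ x = A *ᵥ x := by
  rw [deflation, add_mulVec, vecMulVec_mulVec, smul_dotProduct, hx, smul_zero, MulOpposite.op_zero,
    zero_smul, add_zero]

omit [DecidableEq ι] in
lemma vecMul_deflation_of_dotProduct_eq_zero {v : ι → R} (hv : v ⬝ᵥ y = 0) :
    v ᵥ* deflation A ρ y l = v ᵥ* A := by
  rw [deflation, vecMul_add, vecMul_vecMulVec, hv, zero_smul, add_zero]

omit [DecidableEq ι] in
lemma vecMul_deflation_eq_zero (hlA : l ᵥ* A = ρ • l) (hly : l ⬝ᵥ y = 1) :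
    l ᵥ* deflation A ρ y l = 0 := by
  rw [deflation, vecMul_add, hlA, vecMul_vecMulVec, hly, one_smul, neg_smul, add_neg_cancel]

lemma vecMul_deflation_pow_of_dotProduct_eq_zero (hAy : A *ᵥ y = ρ • y) {v : ι → R}
    (hv : v ⬝ᵥ y = 0) (n : ℕ) : v ᵥ* deflation A ρ y l ^ n = v ᵥ* A ^ n := by
  induction n generalizing v with
  | zero => simp
  | succ n ih =>
    have hvA : (v ᵥ* A) ⬝ᵥ y = 0 := by rw [← dotProduct_mulVec, hAy, dotProduct_smul, hv, smul_zero]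
    rw [pow_succ', pow_succ', ← vecMul_vecMul, ← vecMul_vecMul,
      vecMul_deflation_of_dotProduct_eq_zero hv, ih hvA]

lemma cons_roots_charpoly_deflation [IsDomain R] (hAy : A *ᵥ y = ρ • y) (hly : l ⬝ᵥ y = 1) :
    ρ ::ₘ (deflation A ρ y l).charpoly.roots = 0 ::ₘ A.charpoly.roots := by
  have h := X_sub_C_mul_charpoly_add_vecMulVec hAy (-ρ • l)
  rw [dotProduct_smul, dotProduct_comm, hly, smul_eq_mul, mul_one, add_neg_cancel, C_0,
    sub_zero] at h
  have hroots := congrArg Polynomial.roots h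
  rwa [roots_mul ((monic_X_sub_C _).mul (charpoly_monic _)).ne_zero,
    roots_mul (monic_X.mul (charpoly_monic _)).ne_zero, roots_X_sub_C, roots_X,
    Multiset.singleton_add, Multiset.singleton_add] at hroots

lemma exists_mulVec_eq_smul_of_mem_roots_charpoly {K : Type*} [Field K] {A : Matrix ι ι K} {z : K}
    (hz : z ∈ A.charpoly.roots) : ∃ x ≠ 0, A *ᵥ x = z • x := by
  have hdet := (mem_roots'.1 hz).2
  rw [IsRoot, eval_charpoly, ← exists_mulVec_eq_zero_iff] at hdet
  obtain ⟨x, hx, hzx⟩ := hdet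
  rw [sub_mulVec, sub_eq_zero, scalar_apply, ← smul_one_eq_diagonal, smul_mulVec,
    one_mulVec] at hzx
  exact ⟨x, hx, hzx.symm⟩

end Deflation

lemma norm_lt_of_mem_roots_charpoly_deflation {B : Matrix ι ι ℝ} (hB : B.IsPrimitive) {ρ : ℝ}
    (hρ : 0 < ρ) {y : ι → ℂ} {l : ι → ℝ} (hl : ∀ i, 0 < l i) (hlB : l ᵥ* B = ρ • l)
    (hly : ((↑) ∘ l) ⬝ᵥ y = 1) {z : ℂ}
    (hz : z ∈ (deflation (B.map ((↑) : ℝ → ℂ)) ρ y ((↑) ∘ l)).charpoly.roots) : ‖z‖ < ρ := by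
  rcases eq_or_ne z 0 with rfl | hz0
  · simpa
  obtain ⟨x, hx, hzx⟩ := exists_mulVec_eq_smul_of_mem_roots_charpoly hz
  have hlA : ((↑) ∘ l) ᵥ* B.map ((↑) : ℝ → ℂ) = (ρ : ℂ) • ((↑) ∘ l) := by
    ext j
    exact (Complex.ofRealHom.map_vecMul B l j).symm.trans (by simp [hlB])
  have hlx : ((↑) ∘ l) ⬝ᵥ x = 0 := by
    have h := dotProduct_mulVec ((↑) ∘ l) (deflation (B.map ((↑) : ℝ → ℂ)) ρ y ((↑) ∘ l)) x
    rw [vecMul_deflation_eq_zero hlA hly, zero_dotProduct, hzx, dotProduct_smul] at h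
    exact (smul_eq_zero.1 h).resolve_left hz0
  rw [deflation_mulVec_of_dotProduct_eq_zero hlx] at hzx
  exact norm_eigenvalue_lt_of_isPrimitive hB hρ hl hlB hx hzx hlx

lemma eq_and_eq_cons_of_cons_eq_cons_zero {ρ : ℝ} (hρ : 0 < ρ) {s : Multiset ℂ}
    (hs : ∀ z ∈ s, ‖z‖ < ρ) {θ : ℂ} {L : List ℂ} (hL : ∀ z ∈ L, ‖z‖ ≤ ‖θ‖)
    (h : (ρ : ℂ) ::ₘ s = 0 ::ₘ ↑(θ :: L)) : θ = ρ ∧ s = 0 ::ₘ ↑L := by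
  have hρθ : ρ ≤ ‖θ‖ := by
    have hmem : (ρ : ℂ) ∈ (0 : ℂ) ::ₘ ↑(θ :: L) := h ▸ Multiset.mem_cons_self _ _
    have hnorm : ‖(ρ : ℂ)‖ = ρ := Complex.norm_of_nonneg hρ.le
    rcases Multiset.mem_cons.1 hmem with h0 | hmem
    · exact absurd (Complex.ofReal_eq_zero.1 h0) hρ.ne'
    rcases List.mem_cons.1 (Multiset.mem_coe.1 hmem) with h1 | hmem
    · rw [← h1, hnorm]
    · exact hnorm ▸ hL _ hmem
  have hθ : θ = ρ := by
    have hmem : θ ∈ (ρ : ℂ) ::ₘ s := by simp [h]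
    exact (Multiset.mem_cons.1 hmem).resolve_right fun hθs => (hs θ hθs).not_ge hρθ
  refine ⟨hθ, ?_⟩
  rwa [hθ, ← Multiset.cons_coe, Multiset.cons_swap, Multiset.cons_inj_right] at h

section NormedMatrix

attribute [local instance] Matrix.linftyOpNormedRing Matrix.linftyOpNormedAlgebra

lemma exists_norm_vecMul_pow_le {A : Matrix ι ι ℂ} {R : ℝ} (hR : 0 < R)
    (hA : ∀ z ∈ A.charpoly.roots, ‖z‖ ≤ R) {d : ℕ}
    (hd : A.charpoly.roots.countP (fun z => ‖z‖ = R) = d + 1) :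
    ∃ K, ∀ (v : ι → ℂ) (n : ℕ), ‖v ᵥ* A ^ n‖ ≤ K * (n + 1) ^ d * R ^ n * ‖v‖ := by
  have hzero : aeval Aᵀ (A.charpoly.roots.map fun z => X - C z).prod = 0 := by
    rw [← (IsAlgClosed.splits A.charpoly).eq_prod_roots_of_monic A.charpoly_monic,
      ← charpoly_transpose, aeval_self_charpoly]
  obtain ⟨K, hK⟩ := exists_norm_pow_le_of_aeval_prod_eq_zero hR hA hd hzero
  refine ⟨K, fun v n => ?_⟩
  rw [← mulVec_transpose, transpose_pow]
  exact (linfty_opNorm_mulVec _ v).trans (by gcongr; exact hK n)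

end NormedMatrix

theorem exists_perron_and_norm_vecMul_pow_le {B : Matrix ι ι ℝ} (hB : B.IsPrimitive) {θ₁ θ₂ : ℂ}
    {rest : List ℂ}
    (hroots : ((θ₁ :: θ₂ :: rest : List ℂ) : Multiset ℂ) = (B.map ((↑) : ℝ → ℂ)).charpoly.roots)
    (hsorted : (θ₁ :: θ₂ :: rest).Pairwise fun z w => ‖w‖ ≤ ‖z‖) (hθ₂ : θ₂ ≠ 0) {α : ℕ}
    (hα : (θ₁ :: θ₂ :: rest).countP (fun z => ‖z‖ = ‖θ₂‖) = α + 1) :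
    ‖θ₂‖ < ‖θ₁‖ ∧ ∃ y l : ι → ℝ, (∀ i, 0 < y i) ∧ (∀ i, 0 < l i) ∧ l ᵥ* B = ‖θ₁‖ • l ∧
      ∃ K, ∀ v : ι → ℂ, v ⬝ᵥ ((↑) ∘ y) = 0 →
        ∀ n : ℕ, ‖v ᵥ* B.map ((↑) : ℝ → ℂ) ^ n‖ ≤ K * (n + 1) ^ α * ‖θ₂‖ ^ n * ‖v‖ := by
  have : Nonempty ι := by
    by_contra h
    rw [not_nonempty_iff] at h
    rw [charpoly, det_isEmpty, roots_one] at hroots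
    simp at hroots
  obtain ⟨ρ, hρ, y, l, hy, hl, hBy, hlB, hly⟩ := exists_perron_eigenvectors hB
  set A := B.map ((↑) : ℝ → ℂ)
  have hAy : A *ᵥ ((↑) ∘ y) = (ρ : ℂ) • ((↑) ∘ y) := by
    ext i
    exact (Complex.ofRealHom.map_mulVec B y i).symm.trans (by simp [hBy])
  have hly' : (((↑) : ℝ → ℂ) ∘ l) ⬝ᵥ ((↑) ∘ y) = 1 := by
    exact (Complex.ofRealHom.map_dotProduct l y).symm.trans (by simp [hly])
  set D := deflation A ρ ((↑) ∘ y) ((↑) ∘ l)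
  have hD : ∀ z ∈ D.charpoly.roots, ‖z‖ < ρ := fun z hz =>
    norm_lt_of_mem_roots_charpoly_deflation hB hρ hl hlB hly' hz
  rw [List.pairwise_cons, List.pairwise_cons] at hsorted
  obtain ⟨hθ₁, hDroots⟩ := eq_and_eq_cons_of_cons_eq_cons_zero hρ hD hsorted.1
    (hroots ▸ cons_roots_charpoly_deflation hAy hly')
  have hθ₁ρ : ‖θ₁‖ = ρ := by rw [hθ₁, Complex.norm_of_nonneg hρ.le]
  have hlt : ‖θ₂‖ < ‖θ₁‖ := by
    rw [hθ₁ρ]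
    exact hD θ₂ (by simp [hDroots])
  have hcount : D.charpoly.roots.countP (fun z => ‖z‖ = ‖θ₂‖) = α + 1 := by
    rw [← hα, hDroots, Multiset.countP_cons_of_neg _ (by simpa using (norm_ne_zero_iff.2 hθ₂).symm),
      List.countP_cons_of_neg (by simpa using hlt.ne'), Multiset.coe_countP]
  have hle : ∀ z ∈ D.charpoly.roots, ‖z‖ ≤ ‖θ₂‖ := by
    simpa [hDroots] using hsorted.2.1
  obtain ⟨K, hK⟩ := exists_norm_vecMul_pow_le (norm_pos_iff.2 hθ₂) hle hcount
  refine ⟨hlt, y, l, hy, hl, hθ₁ρ ▸ hlB, K, fun v hv n => ?_⟩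
  rw [← vecMul_deflation_pow_of_dotProduct_eq_zero hAy hv]
  exact hK v n

end Perron

section Words

variable {ι κ E : Type*}

lemma norm_sum_map_le [SeminormedAddCommGroup E] {v : ι → E} {M : ℝ} (hv : ∀ a, ‖v a‖ ≤ M)
    (w : List ι) : ‖(w.map v).sum‖ ≤ w.length * M := by
  induction w with
  | nil => simp
  | cons a w ih =>
    rw [List.map_cons, List.sum_cons, List.length_cons]
    push_cast
    linarith [norm_add_le (v a) (w.map v).sum, hv a]

lemma sum_map_le_length_mul {v : ι → ℝ} {M : ℝ} (hv : ∀ a, v a ≤ M) (w : List ι) :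
    (w.map v).sum ≤ w.length * M := by
  simpa using List.sum_le_card_nsmul (w.map v) M (by simpa using fun a _ => hv a)

lemma length_mul_le_sum_map {v : ι → ℝ} {c : ℝ} (hv : ∀ a, c ≤ v a) (w : List ι) :
    w.length * c ≤ (w.map v).sum := by
  simpa using List.card_nsmul_le_sum (w.map v) c (by simpa using fun a _ => hv a)

lemma exists_eq_append_of_prefix_flatMap {f : ι → List κ} {L : ℕ} (hL : ∀ a, (f a).length ≤ L)
    (u : List ι) : ∀ w, w <+: u.flatMap f →
      ∃ u' q, u' <+: u ∧ q.length ≤ L ∧ w = u'.flatMap f ++ q := by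
  induction u with
  | nil => exact fun w hw => ⟨[], [], by simp, by simp, by simpa using hw⟩
  | cons c u ih =>
    intro w hw
    rw [List.flatMap_cons] at hw
    rcases List.prefix_or_prefix_of_prefix hw (List.prefix_append (f c) (u.flatMap f)) with h | h
    · exact ⟨[], w, by simp, h.length_le.trans (hL c), by simp⟩
    · obtain ⟨t, rfl⟩ := h
      obtain ⟨u', q, hu', hq, rfl⟩ := ih t ((List.prefix_append_right_inj _).mp hw)
      exact ⟨c :: u', q, by simpa using hu', hq, by simp⟩

lemma exists_eq_append_of_infix_flatMap {f : ι → List κ} {L : ℕ} (hL : ∀ a, (f a).length ≤ L)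
    (u : List ι) : ∀ w, w <:+: u.flatMap f →
      ∃ p u' q, u' <:+: u ∧ p.length ≤ L ∧ q.length ≤ L ∧ w = p ++ u'.flatMap f ++ q := by
  induction u with
  | nil => exact fun w hw => ⟨[], [], [], by simp, by simp, by simp, by simpa using hw⟩
  | cons c u ih =>
    intro w hw
    rw [List.flatMap_cons, List.infix_append_iff] at hw
    rcases hw with h | h | ⟨t₁, t₂, rfl, h₁, h₂⟩
    · exact ⟨w, [], [], by simp, h.length_le.trans (hL c), by simp, by simp⟩
    · obtain ⟨p, u', q, hu', hp, hq, rfl⟩ := ih w h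
      exact ⟨p, u', q, List.infix_cons hu', hp, hq, rfl⟩
    · obtain ⟨u', q, hu', hq, rfl⟩ := exists_eq_append_of_prefix_flatMap hL u t₂ h₂
      exact ⟨t₁, u', q, List.infix_cons hu'.isInfix, h₁.length_le.trans (hL c), hq, by simp⟩

end Words

section Language

variable {m : ℕ}

/-- The language of a substitution: all subwords of the words `ζ^k(a)`. -/
def language (ζ : Substitution m) : Set (List (Fin m)) :=
  {w | ∃ (k : ℕ) (a : Fin m), w <:+: ζ.iter k a}

lemma sum_map_word {R : Type*} [CommSemiring R] (ζ : Substitution m) (v : Fin m → R) (b : Fin m) :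
    ((ζ.word b).map v).sum = (v ᵥ* ζ.matrix.map (Nat.cast : ℕ → R)) b := by
  rw [Finset.sum_list_map_count,
    Finset.sum_subset (Finset.subset_univ _) fun a _ ha => by
      rw [List.count_eq_zero.mpr (by simpa using ha), zero_smul]]
  simp [vecMul, dotProduct, Substitution.matrix, mul_comm]

lemma sum_map_apply {R : Type*} [CommSemiring R] (ζ : Substitution m) (v : Fin m → R)
    (u : List (Fin m)) :
    ((ζ.apply u).map v).sum = (u.map (v ᵥ* ζ.matrix.map (Nat.cast : ℕ → R))).sum := by
  induction u with
  | nil => rfl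
  | cons a u ih =>
    rw [List.map_cons, List.sum_cons, ← ih, ← sum_map_word, ← List.sum_append, ← List.map_append,
      Substitution.apply, List.flatMap_cons]
    rfl

lemma exists_word_length_le (ζ : Substitution m) : ∃ L, 1 ≤ L ∧ ∀ a, (ζ.word a).length ≤ L :=
  ⟨Finset.univ.sup (fun a => (ζ.word a).length) + 1, by omega, fun a =>
    (Finset.le_sup (f := fun a => (ζ.word a).length) (Finset.mem_univ a)).trans (Nat.le_succ _)⟩

variable {ζ : Substitution m}

lemma exists_desubstitution {L : ℕ} (hL1 : 1 ≤ L) (hL : ∀ a, (ζ.word a).length ≤ L)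
    {w : List (Fin m)} (hw : w ∈ language ζ) :
    ∃ p u q, u ∈ language ζ ∧ p.length ≤ L ∧ q.length ≤ L ∧ w = p ++ ζ.apply u ++ q := by
  obtain ⟨k, a, hw⟩ := hw
  cases k with
  | zero =>
    have hw1 : w.length ≤ 1 := hw.length_le
    exact ⟨w, [], [], ⟨0, a, List.nil_infix⟩, hw1.trans hL1, by simp, by simp [Substitution.apply]⟩
  | succ k =>
    rw [Substitution.iter, Function.iterate_succ_apply'] at hw
    obtain ⟨p, u, q, hu, hp, hq, rfl⟩ := exists_eq_append_of_infix_flatMap hL _ _ hw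
    exact ⟨p, u, q, ⟨k, a, hu⟩, hp, hq, rfl⟩

lemma exists_iterated_desubstitution {L : ℕ} (hL1 : 1 ≤ L) (hL : ∀ a, (ζ.word a).length ≤ L)
    {l : Fin m → ℝ} {ρ : ℝ} (hρ : 0 < ρ) (hl : ∀ a, 0 < l a)
    (hlρ : l ᵥ* ζ.matrix.map (Nat.cast : ℕ → ℝ) = ρ • l) (v : Fin m → ℂ)
    {w : List (Fin m)} (hw : w ∈ language ζ) (j : ℕ) :
    ∃ u ∈ language ζ, ρ ^ j * (u.map l).sum ≤ (w.map l).sum ∧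
      ‖(w.map v).sum‖ ≤
        2 * L * ∑ i ∈ Finset.range j, ‖v ᵥ* ζ.matrix.map (Nat.cast : ℕ → ℂ) ^ i‖ +
          ‖(u.map (v ᵥ* ζ.matrix.map (Nat.cast : ℕ → ℂ) ^ j)).sum‖ := by
  induction j with
  | zero => exact ⟨w, hw, by simp, by simp⟩
  | succ j ih =>
    obtain ⟨u, hu, hlu, hvu⟩ := ih
    obtain ⟨p, u', q, hu', hp, hq, rfl⟩ := exists_desubstitution hL1 hL hu
    set vj := v ᵥ* ζ.matrix.map (Nat.cast : ℕ → ℂ) ^ j with hvj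
    have hl0 : ∀ w' : List (Fin m), 0 ≤ (w'.map l).sum := fun w' =>
      List.sum_nonneg (by simpa using fun a _ => (hl a).le)
    have hend : ∀ w' : List (Fin m), w'.length ≤ L → ‖(w'.map vj).sum‖ ≤ L * ‖vj‖ :=
      fun w' hw' => (norm_sum_map_le (norm_le_pi_norm vj) w').trans (by gcongr)
    refine ⟨u', hu', le_trans ?_ hlu, hvu.trans ?_⟩
    · have hlu' : ((ζ.apply u').map l).sum = ρ * (u'.map l).sum := by
        rw [sum_map_apply, hlρ, ← List.sum_map_mul_left]; rfl
      rw [List.map_append, List.map_append, List.sum_append, List.sum_append, hlu', pow_succ,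
        mul_assoc]
      gcongr
      linarith [hl0 p, hl0 q]
    · rw [List.map_append, List.map_append, List.sum_append, List.sum_append, sum_map_apply, hvj,
        vecMul_vecMul, ← pow_succ, ← hvj, Finset.sum_range_succ, mul_add]
      linarith [norm_add₃_le (a := (p.map vj).sum) (c := (q.map vj).sum)
        (b := (u'.map (v ᵥ* ζ.matrix.map (Nat.cast : ℕ → ℂ) ^ (j + 1))).sum),
        hend p hp, hend q hq]

lemma sum_range_pow_mul_pow_le {R : ℝ} (hR : 1 < R) (α j : ℕ) :
    ∑ i ∈ Finset.range j, ((i : ℝ) + 1) ^ α * R ^ i ≤ (j + 1) ^ α * R ^ j / (R - 1) := by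
  have : 0 < R - 1 := by linarith
  calc ∑ i ∈ Finset.range j, ((i : ℝ) + 1) ^ α * R ^ i
      ≤ ∑ i ∈ Finset.range j, ((j : ℝ) + 1) ^ α * R ^ i := by
        refine Finset.sum_le_sum fun i hi => ?_
        have : (i : ℝ) ≤ j := by exact_mod_cast (Finset.mem_range.mp hi).le
        gcongr
    _ = (j + 1) ^ α * ((R ^ j - 1) / (R - 1)) := by rw [← Finset.mul_sum, geom_sum_eq hR.ne']
    _ ≤ (j + 1) ^ α * (R ^ j / (R - 1)) := by gcongr; linarith
    _ = _ := by ring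

lemma exists_norm_sum_map_le_of_length_le_pow {l : Fin m → ℝ} {ρ R : ℝ} (hρ : 0 < ρ) (hR : 1 < R)
    (hl : ∀ a, 0 < l a) (hlρ : l ᵥ* ζ.matrix.map (Nat.cast : ℕ → ℝ) = ρ • l) (α : ℕ) :
    ∃ K, 0 ≤ K ∧ ∀ (v : Fin m → ℂ) (C : ℝ),
      (∀ n : ℕ, ‖v ᵥ* ζ.matrix.map (Nat.cast : ℕ → ℂ) ^ n‖ ≤ C * (n + 1) ^ α * R ^ n) →
      ∀ w ∈ language ζ, ∀ j : ℕ, (w.length : ℝ) ≤ ρ ^ j →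
        ‖(w.map v).sum‖ ≤ K * C * (j + 1) ^ α * R ^ j := by
  rcases isEmpty_or_nonempty (Fin m) with hm | hm
  · exact ⟨0, le_rfl, fun _ _ _ w ⟨_, a, _⟩ => isEmptyElim a⟩
  obtain ⟨L, hL1, hL⟩ := exists_word_length_le ζ
  obtain ⟨a₀, ha₀⟩ := Finite.exists_min l
  obtain ⟨a₁, ha₁⟩ := Finite.exists_max l
  have hl0 := hl a₀
  have hl1 := hl a₁
  have : 0 < R - 1 := by linarith
  refine ⟨2 * L / (R - 1) + l a₁ / l a₀, by positivity, fun v C hC w hw j hj => ?_⟩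
  have hC0 : 0 ≤ C := (norm_nonneg v).trans (by simpa using hC 0)
  obtain ⟨u, -, hlu, hvu⟩ := exists_iterated_desubstitution hL1 hL hρ hl hlρ v hw j
  have hlen : (u.length : ℝ) ≤ l a₁ / l a₀ := by
    have hlu' : ρ ^ j * (u.map l).sum ≤ ρ ^ j * l a₁ :=
      (hlu.trans (sum_map_le_length_mul ha₁ w)).trans (by gcongr)
    rw [le_div_iff₀ hl0]
    exact (length_mul_le_sum_map ha₀ u).trans (le_of_mul_le_mul_left hlu' (by positivity))
  calc ‖(w.map v).sum‖
      ≤ 2 * L * ∑ i ∈ Finset.range j, C * (((i : ℝ) + 1) ^ α * R ^ i)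
        + l a₁ / l a₀ * (C * (j + 1) ^ α * R ^ j) := by
        refine hvu.trans ?_
        gcongr with i _
        · simpa only [mul_assoc] using hC i
        · exact (norm_sum_map_le (norm_le_pi_norm _) u).trans
            (mul_le_mul hlen (hC j) (norm_nonneg _) (by positivity))
    _ ≤ 2 * L * (C * ((j + 1) ^ α * R ^ j / (R - 1)))
        + l a₁ / l a₀ * (C * (j + 1) ^ α * R ^ j) := by
        rw [← Finset.mul_sum]
        gcongr
        exact sum_range_pow_mul_pow_le hR α j
    _ = _ := by ring

lemma pow_ceil_logb_le {ρ R N : ℝ} (hρ : 1 < ρ) (hR : 1 < R) (hN : 1 ≤ N) :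
    R ^ ⌈Real.logb ρ N⌉₊ ≤ R * N ^ Real.logb ρ R := by
  have hlog : 0 ≤ Real.logb ρ N := Real.logb_nonneg hρ hN
  have hcomm : N ^ Real.logb ρ R = R ^ Real.logb ρ N := by
    rw [Real.rpow_def_of_pos (by linarith), Real.rpow_def_of_pos (by linarith), Real.logb,
      Real.logb, mul_div_left_comm]
  rw [hcomm, ← Real.rpow_natCast, mul_comm, ← Real.rpow_add_one (by linarith)]
  exact Real.rpow_le_rpow_of_exponent_le hR.le (Nat.ceil_lt_add_one hlog).le

lemma exists_norm_sum_map_le_of_length_le {l : Fin m → ℝ} {ρ R : ℝ} (hρ : 1 < ρ) (hR : 1 < R)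
    (hl : ∀ a, 0 < l a) (hlρ : l ᵥ* ζ.matrix.map (Nat.cast : ℕ → ℝ) = ρ • l) (α : ℕ) :
    ∃ K, 0 ≤ K ∧ ∀ (v : Fin m → ℂ) (C : ℝ),
      (∀ n : ℕ, ‖v ᵥ* ζ.matrix.map (Nat.cast : ℕ → ℂ) ^ n‖ ≤ C * (n + 1) ^ α * R ^ n) →
      ∀ w ∈ language ζ, ∀ N : ℝ, 1 ≤ N → w.length ≤ N →
        ‖(w.map v).sum‖ ≤ K * C * (1 + Real.log N) ^ α * N ^ Real.logb ρ R := by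
  obtain ⟨K, hK0, hK⟩ := exists_norm_sum_map_le_of_length_le_pow (zero_lt_one.trans hρ) hR hl hlρ α
  have hlogρ : 0 < Real.log ρ := Real.log_pos hρ
  set c := 2 + (Real.log ρ)⁻¹
  refine ⟨K * c ^ α * R, by positivity, fun v C hC w hw N hN hwN => ?_⟩
  have hC0 : 0 ≤ C := (norm_nonneg v).trans (by simpa using hC 0)
  have hlogN : 0 ≤ Real.log N := Real.log_nonneg hN
  have : 0 < c := by positivity
  set j := ⌈Real.logb ρ N⌉₊
  have hj : (w.length : ℝ) ≤ ρ ^ j := by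
    refine hwN.trans ?_
    rw [← Real.rpow_natCast, ← Real.logb_le_iff_le_rpow hρ (by linarith)]
    exact Nat.le_ceil _
  have hj1 : (j : ℝ) + 1 ≤ c * (1 + Real.log N) := by
    have hceil : (j : ℝ) < Real.logb ρ N + 1 := Nat.ceil_lt_add_one (Real.logb_nonneg hρ hN)
    rw [← Real.log_div_log, div_eq_inv_mul] at hceil
    have hinv : 0 < (Real.log ρ)⁻¹ := inv_pos.2 hlogρ
    simp only [c]
    nlinarith
  calc ‖(w.map v).sum‖ ≤ K * C * (j + 1) ^ α * R ^ j := hK v C hC w hw j hj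
    _ ≤ K * C * (c * (1 + Real.log N)) ^ α * (R * N ^ Real.logb ρ R) := by
        gcongr
        exact pow_ceil_logb_le hρ hR hN
    _ = _ := by rw [mul_pow]; ring

end Language

lemma integral_comp_of_measurePreserving {X Y E : Type*} [MeasurableSpace X] [MeasurableSpace Y]
    [NormedAddCommGroup E] [NormedSpace ℝ E] {μ : Measure X} {ν : Measure Y} {T : X → Y}
    (hT : MeasurePreserving T μ ν) {f : Y → E} (hf : AEStronglyMeasurable f ν) :
    ∫ x, f (T x) ∂μ = ∫ y, f y ∂ν := by
  rw [← hT.map_eq] at hf ⊢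
  exact (integral_map hT.measurable.aemeasurable hf).symm

section Frequencies

variable {m : ℕ} {ζ : Substitution m} {μ : Measure (Space ζ)}

lemma block_succ (x : ℤ → Fin m) (i : ℤ) (n : ℕ) :
    block x i (n + 1) = block x i n ++ [x (i + n)] := by
  simp [block, List.range_succ]

lemma length_block (x : ℤ → Fin m) (i : ℤ) (n : ℕ) : (block x i n).length = n := by
  simp [block]

lemma block_mem_language (x : Space ζ) (i : ℤ) (n : ℕ) : block x.1 i n ∈ language ζ := by
  obtain ⟨k, a, h⟩ := x.2 (i.natAbs + n)
  refine ⟨k, a, List.IsInfix.trans ?_ h⟩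
  obtain ⟨p, hp⟩ : ∃ p : ℕ, i = -((i.natAbs + n : ℕ) : ℤ) + p :=
    ⟨(i + (i.natAbs + n : ℕ)).toNat, by omega⟩
  obtain ⟨q, hq⟩ : ∃ q : ℕ, 2 * (i.natAbs + n) + 1 = p + n + q :=
    ⟨2 * (i.natAbs + n) + 1 - (p + n), by omega⟩
  rw [hq]
  conv_lhs => rw [hp]
  exact block_infix x.1 _ p n q

lemma measurable_coord (n : ℤ) : Measurable fun x : Space ζ => x.1 n :=
  (measurable_pi_apply n).comp measurable_subtype_coe

lemma integrable_coord [IsFiniteMeasure μ] (v : Fin m → ℂ) (n : ℤ) :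
    Integrable (fun x : Space ζ => v (x.1 n)) μ :=
  .of_bound ((Measurable.of_discrete (f := v)).comp (measurable_coord n)).aestronglyMeasurable ‖v‖
    (.of_forall fun x => norm_le_pi_norm v (x.1 n))

lemma integral_coord (hμ : MeasurePreserving (shift ζ 1) μ μ) (v : Fin m → ℂ) (n : ℕ) :
    ∫ x : Space ζ, v (x.1 n) ∂μ = ∫ x : Space ζ, v (x.1 0) ∂μ := by
  induction n with
  | zero => rfl
  | succ n ih =>
    rw [← ih, ← integral_comp_of_measurePreserving hμ (f := fun x : Space ζ => v (x.1 n))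
      ((Measurable.of_discrete (f := v)).comp (measurable_coord n)).aestronglyMeasurable]
    simp [shift]

lemma integral_sum_map_block [IsFiniteMeasure μ] (hμ : MeasurePreserving (shift ζ 1) μ μ)
    (v : Fin m → ℂ) (n : ℕ) :
    ∫ x : Space ζ, ((block x.1 0 n).map v).sum ∂μ = n * ∫ x : Space ζ, v (x.1 0) ∂μ := by
  have hsum : ∀ x : Space ζ, ((block x.1 0 n).map v).sum = ∑ k ∈ Finset.range n, v (x.1 k) :=
    fun x => by simp [block, Finset.sum, Multiset.range, Function.comp_def]
  simp only [hsum]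
  rw [integral_finsetSum _ fun (k : ℕ) _ => integrable_coord v k]
  simp only [integral_coord hμ, Finset.sum_const, Finset.card_range, nsmul_eq_mul]

lemma integral_coord_eq_zero_of_isLittleO [IsProbabilityMeasure μ]
    (hμ : MeasurePreserving (shift ζ 1) μ μ) {v : Fin m → ℂ} {b : ℕ → ℝ}
    (hb : b =o[atTop] fun n : ℕ => (n : ℝ))
    (hv : ∀ᶠ n in atTop, ∀ w ∈ language ζ, w.length = n → ‖(w.map v).sum‖ ≤ b n) :
    ∫ x : Space ζ, v (x.1 0) ∂μ = 0 := by
  suffices h : ∀ᶠ n : ℕ in atTop, ‖∫ x : Space ζ, v (x.1 0) ∂μ‖ ≤ b n / n from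
    norm_le_zero_iff.1 (ge_of_tendsto hb.tendsto_div_nhds_zero h)
  filter_upwards [hv, eventually_gt_atTop 0] with n hn hn0
  have hblock := norm_integral_le_of_norm_le_const (μ := μ)
    (.of_forall fun x : Space ζ => hn _ (block_mem_language x 0 n) (length_block x.1 0 n))
  rw [integral_sum_map_block hμ, norm_mul, Complex.norm_natCast, probReal_univ, mul_one] at hblock
  rw [le_div_iff₀ (by positivity)]
  linarith

lemma dotProduct_eq_zero_of_integral_coord_eq_zero [IsProbabilityMeasure μ] {y : Fin m → ℝ}
    (hy : ∀ i, 0 < y i)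
    (hzero : ∀ v : Fin m → ℂ, v ⬝ᵥ ((↑) ∘ y) = 0 → ∫ x : Space ζ, v (x.1 0) ∂μ = 0)
    {v : Fin m → ℂ} (hv : ∫ x : Space ζ, v (x.1 0) ∂μ = 0) : v ⬝ᵥ ((↑) ∘ y) = 0 := by
  obtain ⟨x₀⟩ : Nonempty (Space ζ) := μ.nonempty_of_neZero
  have hsum : ((∑ i, y i : ℝ) : ℂ) ≠ 0 := Complex.ofReal_ne_zero.2
    (Finset.sum_pos (fun i _ => hy i) ⟨x₀.1 0, Finset.mem_univ _⟩).ne'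
  set c := v ⬝ᵥ ((↑) ∘ y) / ((∑ i, y i : ℝ) : ℂ) with hc
  have hvc : (fun i => v i - c) ⬝ᵥ ((↑) ∘ y) = 0 := by
    have hconst : (fun _ => c) ⬝ᵥ ((↑) ∘ y) = c * ((∑ i, y i : ℝ) : ℂ) := by
      simp [dotProduct, Finset.mul_sum]
    rw [show (fun i => v i - c) = v - fun _ => c from rfl, sub_dotProduct, hconst, hc,
      div_mul_cancel₀ _ hsum, sub_self]
  have hc0 : c = 0 := by
    have := hzero _ hvc
    rw [integral_sub (integrable_coord v 0) (integrable_const c), hv] at this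
    simpa using this
  rwa [hc, div_eq_zero_iff, or_iff_left hsum] at hc0

lemma isLittleO_one_add_log_pow_mul_rpow {β : ℝ} (hβ : β < 1) (α : ℕ) :
    (fun x : ℝ => (1 + Real.log x) ^ α * x ^ β) =o[atTop] fun x => x := by
  have hlog : (fun x : ℝ => (1 + Real.log x) ^ α) =o[atTop] fun x => x ^ (1 - β) :=
    ((Real.isLittleO_const_log_atTop.isBigO.add
      (Asymptotics.isBigO_refl _ _)).pow α).trans_isLittleO
      (by simpa using isLittleO_log_rpow_rpow_atTop (α : ℝ) (sub_pos.2 hβ))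
  refine (hlog.mul_isBigO (Asymptotics.isBigO_refl (fun x : ℝ => x ^ β) atTop)).congr' .rfl ?_
  filter_upwards [eventually_gt_atTop 0] with x hx
  rw [← Real.rpow_add hx, sub_add_cancel, Real.rpow_one]

lemma exists_norm_sum_map_le_of_integral_coord_eq_zero [IsProbabilityMeasure μ]
    (hμ : MeasurePreserving (shift ζ 1) μ μ) (hζ : ζ.IsPrimitive) {θ₁ θ₂ : ℂ} {rest : List ℂ}
    (hθ : ζ.IsEigenvalueList (θ₁ :: θ₂ :: rest)) (hθ₂ : 1 < ‖θ₂‖) {α : ℕ}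
    (hα : (θ₁ :: θ₂ :: rest).countP (fun z => ‖z‖ = ‖θ₂‖) = α + 1) :
    ∃ K, 0 ≤ K ∧ ∀ v : Fin m → ℂ, ∫ x : Space ζ, v (x.1 0) ∂μ = 0 →
      ∀ w ∈ language ζ, ∀ N : ℝ, 1 ≤ N → w.length ≤ N →
        ‖(w.map v).sum‖ ≤ K * ‖v‖ * (1 + Real.log N) ^ α * N ^ Real.logb ‖θ₁‖ ‖θ₂‖ := by
  have hmap : (ζ.matrix.map (Nat.cast : ℕ → ℝ)).map ((↑) : ℝ → ℂ)
      = ζ.matrix.map (Nat.cast : ℕ → ℂ) := by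
    ext i j; simp
  obtain ⟨hlt, y, l, hy, hl, hlθ, K₁, hK₁⟩ := exists_perron_and_norm_vecMul_pow_le hζ
    (by rw [hmap]; exact hθ.1) hθ.2 (norm_pos_iff.1 (one_pos.trans hθ₂)) hα
  rw [hmap] at hK₁
  have hθ₁ : 1 < ‖θ₁‖ := hθ₂.trans hlt
  obtain ⟨K₂, hK₂0, hK₂⟩ := exists_norm_sum_map_le_of_length_le hθ₁ hθ₂ hl hlθ α
  have hbound : ∀ v : Fin m → ℂ, v ⬝ᵥ ((↑) ∘ y) = 0 → ∀ w ∈ language ζ, ∀ N : ℝ, 1 ≤ N →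
      w.length ≤ N → ‖(w.map v).sum‖ ≤
        K₂ * (K₁ * ‖v‖) * (1 + Real.log N) ^ α * N ^ Real.logb ‖θ₁‖ ‖θ₂‖ := fun v hv =>
    hK₂ v _ fun n => (hK₁ v hv n).trans_eq (by ring)
  have hβ : Real.logb ‖θ₁‖ ‖θ₂‖ < 1 := by
    rw [Real.logb_lt_iff_lt_rpow hθ₁ (by linarith), Real.rpow_one]; exact hlt
  have hzero : ∀ v : Fin m → ℂ, v ⬝ᵥ ((↑) ∘ y) = 0 → ∫ x : Space ζ, v (x.1 0) ∂μ = 0 := by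
    refine fun v hv => integral_coord_eq_zero_of_isLittleO hμ
      (((isLittleO_one_add_log_pow_mul_rpow hβ α).comp_tendsto
        tendsto_natCast_atTop_atTop).const_mul_left (K₂ * (K₁ * ‖v‖))) ?_
    filter_upwards [eventually_ge_atTop 1] with n hn w hw hwn
    simpa only [Function.comp_apply, mul_assoc] using
      hbound v hv w hw n (by exact_mod_cast hn) (by rw [hwn])
  refine ⟨K₂ * |K₁|, by positivity, fun v hv w hw N hN hwN => ?_⟩
  have hlogN : 0 ≤ Real.log N := Real.log_nonneg hN
  have hyv := dotProduct_eq_zero_of_integral_coord_eq_zero hy hzero hv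
  refine (hbound v hyv w hw N hN hwN).trans ?_
  rw [← mul_assoc]
  gcongr
  exact le_abs_self K₁

end Frequencies

section RoofFlow

variable {m : ℕ} {ζ : Substitution m} {s : Fin m → ℝ}

lemma roofSum_zero (s : Fin m → ℝ) (x : ℤ → Fin m) : roofSum s x 0 = 0 := by simp [roofSum]

lemma roofSum_strictMono (hs : ∀ a, 0 < s a) (x : ℤ → Fin m) : StrictMono (roofSum s x) :=
  strictMono_int_of_lt_succ fun n => by linarith [roofSum_succ s x n, hs (x n)]

lemma roofSum_add (s : Fin m → ℝ) (x : ℤ → Fin m) (n k : ℤ) :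
    roofSum s x (n + k) = roofSum s x n + roofSum s (fun j => x (j + n)) k := by
  induction k using Int.induction_on with
  | zero => simp [roofSum_zero]
  | succ k ih => rw [← add_assoc, roofSum_succ, roofSum_succ, ih, add_comm n, add_assoc]
  | pred k ih =>
    have h₁ := roofSum_succ s x (n + (-k - 1))
    have h₂ := roofSum_succ s (fun j => x (j + n)) (-k - 1)
    rw [add_assoc, sub_add_cancel] at h₁
    rw [sub_add_cancel] at h₂
    rw [add_comm (-(k : ℤ) - 1) n] at h₂
    linarith

lemma roofIndex_eq (hs : ∀ a, 0 < s a) {x : ℤ → Fin m} {u : ℝ} {n : ℤ}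
    (hn : roofSum s x n ≤ u) (hn' : u < roofSum s x (n + 1)) : roofIndex hs x u = n := by
  obtain ⟨hk, hk'⟩ := roofIndex_spec hs x u
  have hmono := roofSum_strictMono hs x
  have hlt := hmono.lt_iff_lt.1 (hn.trans_lt hk')
  have hlt' := hmono.lt_iff_lt.1 (hk.trans_lt hn')
  omega

lemma shift_shift (n k : ℤ) (x : Space ζ) : shift ζ k (shift ζ n x) = shift ζ (n + k) x :=
  Subtype.ext <| funext fun j => congrArg x.1 (by omega)

/-- The quotient map from `Space ζ × ℝ` onto the suspension which identifies `(x, s_{x_0} + u)`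
with `(T x, u)`. -/
noncomputable def toSuspension (hs : ∀ a, 0 < s a) (p : Space ζ × ℝ) : suspension ζ s :=
  ⟨(shift ζ (roofIndex hs p.1.1 p.2) p.1, p.2 - roofSum s p.1.1 (roofIndex hs p.1.1 p.2)), by
    obtain ⟨hn, hn'⟩ := roofIndex_spec hs p.1.1 p.2
    rw [roofSum_succ] at hn'
    refine ⟨sub_nonneg.2 hn, ?_⟩
    simp only [shift, zero_add]
    linarith⟩

lemma coe_toSuspension (hs : ∀ a, 0 < s a) {x : Space ζ} {u : ℝ} {n : ℤ}
    (hn : roofSum s x.1 n ≤ u) (hn' : u < roofSum s x.1 (n + 1)) :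
    (toSuspension hs (x, u)).1 = (shift ζ n x, u - roofSum s x.1 n) := by
  simp only [toSuspension, roofIndex_eq hs hn hn']

lemma toSuspension_coe (hs : ∀ a, 0 < s a) (y : suspension ζ s) : toSuspension hs y.1 = y := by
  refine Subtype.ext ?_
  rw [← Prod.mk.eta (p := y.1), coe_toSuspension hs (n := 0), roofSum_zero]
  · simp [shift]
  · simpa only [roofSum_zero] using y.2.1
  · rw [roofSum_succ, roofSum_zero, zero_add]
    exact y.2.2

lemma toSuspension_shift (hs : ∀ a, 0 < s a) (n : ℤ) (x : Space ζ) (u : ℝ) :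
    toSuspension hs (shift ζ n x, u) = toSuspension hs (x, u + roofSum s x.1 n) := by
  obtain ⟨hk, hk'⟩ := roofIndex_spec hs (shift ζ n x).1 u
  set k := roofIndex hs (shift ζ n x).1 u
  have hadd : ∀ j, roofSum s x.1 (n + j) = roofSum s x.1 n + roofSum s (shift ζ n x).1 j :=
    roofSum_add s x.1 n
  refine Subtype.ext ?_
  rw [coe_toSuspension hs hk hk', coe_toSuspension hs (n := n + k), shift_shift, hadd]
  · congr 1; ring
  · rw [hadd]; linarith
  · rw [add_assoc, hadd]; linarith

lemma flow_toSuspension (hs : ∀ a, 0 < s a) (τ : ℝ) (x : Space ζ) (u : ℝ) :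
    flow ζ hs τ (toSuspension hs (x, u)) = toSuspension hs (x, u + τ) := by
  change toSuspension hs (shift ζ _ x, u - roofSum s x.1 _ + τ) = _
  rw [toSuspension_shift]
  congr 2
  ring

lemma flow_add (hs : ∀ a, 0 < s a) (t τ : ℝ) (y : suspension ζ s) :
    flow ζ hs (t + τ) y = flow ζ hs t (flow ζ hs τ y) := by
  rw [← toSuspension_coe hs y, ← Prod.mk.eta (p := y.1), flow_toSuspension, flow_toSuspension,
    flow_toSuspension, add_comm t, add_assoc]

lemma measurable_shift (n : ℤ) : Measurable (shift ζ n) :=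
  (measurable_pi_lambda _ fun j => measurable_coord (j + n)).subtype_mk

lemma measurable_roofSum (s : Fin m → ℝ) (n : ℤ) :
    Measurable fun x : Space ζ => roofSum s x.1 n :=
  have hterm (j : ℤ) : Measurable fun x : Space ζ => s (x.1 j) :=
    (Measurable.of_discrete (f := s)).comp (measurable_coord j)
  (Finset.measurable_sum _ fun j _ => hterm j).sub (Finset.measurable_sum _ fun j _ => hterm j)

lemma measurable_roofIndex (hs : ∀ a, 0 < s a) :
    Measurable fun p : Space ζ × ℝ => roofIndex hs p.1.1 p.2 := by
  refine measurable_to_countable' fun n => ?_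
  have hpre : (fun p : Space ζ × ℝ => roofIndex hs p.1.1 p.2) ⁻¹' {n}
      = {p | roofSum s p.1.1 n ≤ p.2} ∩ {p | p.2 < roofSum s p.1.1 (n + 1)} := by
    ext p
    refine ⟨?_, fun ⟨hn, hn'⟩ => roofIndex_eq hs hn hn'⟩
    rintro rfl
    exact roofIndex_spec hs p.1.1 p.2
  rw [hpre]
  exact (measurableSet_le ((measurable_roofSum s n).comp measurable_fst) measurable_snd).inter
    (measurableSet_lt measurable_snd ((measurable_roofSum s (n + 1)).comp measurable_fst))

lemma measurable_toSuspension (hs : ∀ a, 0 < s a) :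
    Measurable (toSuspension hs : Space ζ × ℝ → suspension ζ s) := by
  have hpiece : Measurable fun q : ℤ × (Space ζ × ℝ) =>
      (shift ζ q.1 q.2.1, q.2.2 - roofSum s q.2.1.1 q.1) :=
    measurable_from_prod_countable_right fun n =>
      ((measurable_shift n).comp measurable_fst).prodMk
        (measurable_snd.sub ((measurable_roofSum s n).comp measurable_fst))
  exact (hpiece.comp ((measurable_roofIndex hs).prodMk measurable_id)).subtype_mk

lemma measurable_flow (hs : ∀ a, 0 < s a) :
    Measurable fun p : ℝ × suspension ζ s => flow ζ hs p.1 p.2 :=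
  have hcoe : Measurable fun p : ℝ × suspension ζ s => p.2.1 :=
    measurable_subtype_coe.comp measurable_snd
  (measurable_toSuspension hs).comp <|
    (measurable_fst.comp hcoe).prodMk ((measurable_snd.comp hcoe).add measurable_fst)

end RoofFlow

section OrbitIntegrals

variable {m : ℕ} {ζ : Substitution m} {s : Fin m → ℝ}

/-- The cylindrical function of `ψ`, lifted to `Space ζ × ℝ` and read along the line over `x`. -/
noncomputable def orbitFun (hs : ∀ a, 0 < s a) (ψ : Fin m → ℝ → ℂ) (x : Space ζ) (u : ℝ) : ℂ :=
  cylindrical ζ s ψ (toSuspension hs (x, u))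

/-- The integrals of a cylindrical function over the intervals of the roof. -/
noncomputable def letterIntegral (s : Fin m → ℝ) (ψ : Fin m → ℝ → ℂ) (a : Fin m) : ℂ :=
  ∫ t in 0..s a, ψ a t

lemma cylindrical_flow (hs : ∀ a, 0 < s a) (ψ : Fin m → ℝ → ℂ) (τ : ℝ) (y : suspension ζ s) :
    cylindrical ζ s ψ (flow ζ hs τ y) = orbitFun hs ψ y.1.1 (y.1.2 + τ) :=
  rfl

lemma measurable_cylindrical {ψ : Fin m → ℝ → ℂ} (hψ : ∀ a, Measurable (ψ a)) :
    Measurable (cylindrical ζ s ψ) := by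
  have huncurry : Measurable fun q : Fin m × ℝ => ψ q.1 q.2 :=
    measurable_from_prod_countable_right hψ
  exact huncurry.comp <|
    ((measurable_coord 0).comp (measurable_fst.comp measurable_subtype_coe)).prodMk
      (measurable_snd.comp measurable_subtype_coe)

lemma intervalIntegrable_orbitFun (hs : ∀ a, 0 < s a) {ψ : Fin m → ℝ → ℂ} {M : ℝ}
    (hψ : ∀ a, Measurable (ψ a)) (hM : ∀ a t, ‖ψ a t‖ ≤ M) (x : Space ζ) (a b : ℝ) :
    IntervalIntegrable (orbitFun hs ψ x) volume a b := by
  have hmeas : Measurable (orbitFun hs ψ x) := (measurable_cylindrical hψ).comp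
    ((measurable_toSuspension hs).comp measurable_prodMk_left)
  exact intervalIntegrable_iff.2 <| Measure.integrableOn_of_bounded (M := M) (by simp)
    hmeas.aestronglyMeasurable (.of_forall fun _ => hM _ _)

lemma integral_orbitFun_letter (hs : ∀ a, 0 < s a) (ψ : Fin m → ℝ → ℂ) (x : Space ζ) (n : ℤ) :
    ∫ u in roofSum s x.1 n..roofSum s x.1 (n + 1), orbitFun hs ψ x u
      = letterIntegral s ψ (x.1 n) := by
  have hle : roofSum s x.1 n ≤ roofSum s x.1 (n + 1) :=
    (roofSum_strictMono hs x.1).monotone (by simp)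
  calc ∫ u in roofSum s x.1 n..roofSum s x.1 (n + 1), orbitFun hs ψ x u
      = ∫ u in roofSum s x.1 n..roofSum s x.1 (n + 1), ψ (x.1 n) (u - roofSum s x.1 n) := by
        simp only [intervalIntegral.integral_of_le hle, ← integral_Ico_eq_integral_Ioc]
        refine setIntegral_congr_fun measurableSet_Ico fun u hu => ?_
        simp only [orbitFun, cylindrical, coe_toSuspension hs hu.1 hu.2, shift, zero_add]
    _ = letterIntegral s ψ (x.1 n) := by
        rw [intervalIntegral.integral_comp_sub_right (ψ (x.1 n)), sub_self, roofSum_succ,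
          add_sub_cancel_left, letterIntegral]

lemma integral_orbitFun_block (hs : ∀ a, 0 < s a) {ψ : Fin m → ℝ → ℂ} {M : ℝ}
    (hψ : ∀ a, Measurable (ψ a)) (hM : ∀ a t, ‖ψ a t‖ ≤ M) (x : Space ζ) (n : ℤ) (k : ℕ) :
    ∫ u in roofSum s x.1 n..roofSum s x.1 (n + k), orbitFun hs ψ x u
      = ((block x.1 n k).map (letterIntegral s ψ)).sum := by
  have hinteg := intervalIntegrable_orbitFun hs hψ hM x
  induction k with
  | zero => simp [block]
  | succ k ih =>
    rw [block_succ, List.map_append, List.sum_append, ← ih, List.map_singleton, List.sum_singleton,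
      ← integral_orbitFun_letter hs ψ x (n + k),
      intervalIntegral.integral_add_adjacent_intervals (hinteg _ _) (hinteg _ _)]
    push_cast
    rw [add_assoc]

lemma mul_le_roofSum_sub_roofSum {c : ℝ} (hc : ∀ a, c ≤ s a) (x : ℤ → Fin m) (n : ℤ) (k : ℕ) :
    k * c ≤ roofSum s x (n + k) - roofSum s x n := by
  induction k with
  | zero => simp
  | succ k ih =>
    push_cast
    rw [← add_assoc, roofSum_succ]
    linarith [hc (x (n + k))]

lemma exists_norm_integral_orbitFun_le (hs : ∀ a, 0 < s a) {c S : ℝ} (hc : 0 < c)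
    (hcs : ∀ a, c ≤ s a) (hS : ∀ a, s a ≤ S) {ψ : Fin m → ℝ → ℂ} {M : ℝ}
    (hψ : ∀ a, Measurable (ψ a)) (hM : ∀ a t, ‖ψ a t‖ ≤ M) (x : Space ζ) (u : ℝ) {T : ℝ}
    (hT : 0 ≤ T) :
    ∃ w ∈ language ζ, (w.length : ℝ) ≤ (T + S) / c ∧
      ‖∫ t in u..u + T, orbitFun hs ψ x t‖ ≤ ‖(w.map (letterIntegral s ψ)).sum‖ + 2 * (S * M) := by
  obtain ⟨hn, hn'⟩ := roofIndex_spec hs x.1 u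
  obtain ⟨hk, hk'⟩ := roofIndex_spec hs x.1 (u + T)
  set n := roofIndex hs x.1 u
  have hnk : n ≤ roofIndex hs x.1 (u + T) := Int.lt_add_one_iff.1 <|
    (roofSum_strictMono hs x.1).lt_iff_lt.1 <| by linarith
  obtain ⟨k, hnk⟩ := Int.le.dest hnk
  rw [← hnk] at hk hk'
  rw [roofSum_succ] at hn' hk'
  have hM0 : 0 ≤ M := (norm_nonneg _).trans (hM (x.1 0) 0)
  have hshort : ∀ a b : ℝ, a ≤ b → b ≤ a + S → ‖∫ t in a..b, orbitFun hs ψ x t‖ ≤ S * M := by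
    intro a b hab hb
    refine (intervalIntegral.norm_integral_le_of_norm_le_const fun t _ => hM _ _).trans ?_
    rw [abs_of_nonneg (sub_nonneg.2 hab), mul_comm]
    gcongr
    linarith
  refine ⟨block x.1 n k, block_mem_language x n k, ?_, ?_⟩
  · rw [length_block, le_div_iff₀ hc]
    linarith [mul_le_roofSum_sub_roofSum hcs x.1 n k, hS (x.1 n)]
  · have hinteg := intervalIntegrable_orbitFun hs hψ hM x
    have hsplit : ∫ t in u..u + T, orbitFun hs ψ x t
        = (∫ t in roofSum s x.1 n..roofSum s x.1 (n + k), orbitFun hs ψ x t)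
          - (∫ t in roofSum s x.1 n..u, orbitFun hs ψ x t)
          + ∫ t in roofSum s x.1 (n + k)..u + T, orbitFun hs ψ x t := by
      rw [intervalIntegral.integral_interval_sub_left (hinteg _ _) (hinteg _ _),
        intervalIntegral.integral_add_adjacent_intervals (hinteg _ _) (hinteg _ _)]
    rw [hsplit, integral_orbitFun_block hs hψ hM, two_mul, ← add_assoc]
    refine (norm_add_le _ _).trans (add_le_add ((norm_sub_le _ _).trans (by
      gcongr; exact hshort _ _ hn (by linarith [hS (x.1 n)])))
      (hshort _ _ hk (by linarith [hS (x.1 (n + k))])))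

end OrbitIntegrals

section UnderRoof

variable {X E : Type*} {g : X → ℝ} [NormedAddCommGroup E] [NormedSpace ℝ E]

lemma intervalIntegral_comp_add {f : ℝ → E} (hf : ∀ a b, IntervalIntegrable f volume a b)
    (a τ : ℝ) :
    ∫ u in 0..a, f (u + τ)
      = (∫ u in 0..a, f u) + ((∫ u in 0..τ, f (u + a)) - ∫ u in 0..τ, f u) := by
  rw [intervalIntegral.integral_comp_add_right, intervalIntegral.integral_comp_add_right, zero_add,
    zero_add, add_comm τ, ← add_sub_assoc,
    intervalIntegral.integral_add_adjacent_intervals (hf _ _) (hf _ _),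
    intervalIntegral.integral_interval_sub_left (hf _ _) (hf _ _)]

/-- The region under the graph of a roof function `g`: a fundamental domain for the suspension with
roof `g`. -/
def underRoof (g : X → ℝ) : Set (X × ℝ) := {p | 0 ≤ p.2 ∧ p.2 < g p.1}

lemma integral_indicator_underRoof {F : X × ℝ → E} {x : X} (hx : 0 ≤ g x) :
    ∫ u, (underRoof g).indicator F (x, u) = ∫ u in 0..g x, F (x, u) := by
  rw [intervalIntegral.integral_of_le hx, ← integral_Ico_eq_integral_Ioc,
    ← integral_indicator measurableSet_Ico]
  rfl

variable [MeasurableSpace X] {μ : Measure X}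

lemma measurableSet_underRoof (hg : Measurable g) : MeasurableSet (underRoof g) :=
  (measurableSet_le measurable_const measurable_snd).inter
    (measurableSet_lt measurable_snd (hg.comp measurable_fst))

lemma prod_underRoof (hg : Measurable g) :
    (μ.prod volume) (underRoof g) = ∫⁻ x, ENNReal.ofReal (g x) ∂μ := by
  rw [Measure.prod_apply (measurableSet_underRoof hg)]
  refine lintegral_congr fun x => ?_
  change volume (Set.Ico 0 (g x)) = _
  rw [Real.volume_Ico, sub_zero]

lemma prod_underRoof_lt_top (hg : Measurable g) (hgi : Integrable g μ) :
    (μ.prod volume) (underRoof g) < ⊤ := by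
  rw [prod_underRoof hg]
  exact hgi.lintegral_lt_top

lemma setIntegral_underRoof [SFinite μ] (hg : Measurable g) (hg₀ : 0 ≤ g) {F : X × ℝ → E}
    (hF : IntegrableOn F (underRoof g) (μ.prod volume)) :
    ∫ p in underRoof g, F p ∂(μ.prod volume) = ∫ x, (∫ u in 0..g x, F (x, u)) ∂μ := by
  have hmeas := measurableSet_underRoof hg
  rw [← integral_indicator hmeas, integral_prod _ (hF.integrable_indicator hmeas)]
  exact integral_congr_ae (.of_forall fun x => integral_indicator_underRoof (hg₀ x))

lemma integrable_intervalIntegral_underRoof (hg : Measurable g) (hg₀ : 0 ≤ g) {F : X × ℝ → E}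
    (hF : IntegrableOn F (underRoof g) (μ.prod volume)) :
    Integrable (fun x => ∫ u in 0..g x, F (x, u)) μ :=
  (hF.integrable_indicator (measurableSet_underRoof hg)).integral_prod_left.congr
    (.of_forall fun x => integral_indicator_underRoof (hg₀ x))

lemma setIntegral_underRoof_comp_add [IsFiniteMeasure μ] (hg : Measurable g) (hg₀ : 0 ≤ g)
    (hgi : Integrable g μ) {T : X → X} (hT : MeasurePreserving T μ μ) {H : X × ℝ → E} {M : ℝ}
    (hH : StronglyMeasurable H) (hM : ∀ p, ‖H p‖ ≤ M)
    (hHT : ∀ x u, H (T x, u) = H (x, u + g x)) (τ : ℝ) :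
    ∫ p in underRoof g, H (p.1, p.2 + τ) ∂(μ.prod volume)
      = ∫ p in underRoof g, H p ∂(μ.prod volume) := by
  have hHτ : StronglyMeasurable fun p : X × ℝ => H (p.1, p.2 + τ) :=
    hH.comp_measurable (measurable_fst.prodMk (measurable_snd.add_const τ))
  have hon {F : X × ℝ → E} (hF : StronglyMeasurable F) (hFM : ∀ p, ‖F p‖ ≤ M) :
      IntegrableOn F (underRoof g) (μ.prod volume) :=
    Measure.integrableOn_of_bounded (prod_underRoof_lt_top hg hgi).ne hF.aestronglyMeasurable
      (.of_forall hFM)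
  have hinteg (x : X) (a b : ℝ) : IntervalIntegrable (fun u => H (x, u)) volume a b :=
    intervalIntegrable_iff.2 <| Measure.integrableOn_of_bounded (M := M) (by simp)
      (hH.comp_measurable measurable_prodMk_left).aestronglyMeasurable (.of_forall fun _ => hM _)
  set J : X → E := fun x => ∫ u in 0..τ, H (x, u)
  have hJ : Integrable J μ := .of_bound
    (hH.integral_prod_right'.sub hH.integral_prod_right').aestronglyMeasurable (M * |τ - 0|)
    (.of_forall fun x => intervalIntegral.norm_integral_le_of_norm_le_const fun u _ => hM _)
  have hJT : Integrable (fun x => J (T x)) μ := hT.integrable_comp_of_integrable hJ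
  have hcoboundary : Integrable (fun x => J (T x) - J x) μ := hJT.sub hJ
  -- Translation by `τ` changes the integral over the fibre by the coboundary `J ∘ T - J`.
  have htranslate (x : X) :
      ∫ u in 0..g x, H (x, u + τ) = (∫ u in 0..g x, H (x, u)) + (J (T x) - J x) := by
    simp only [J, hHT]
    exact intervalIntegral_comp_add (hinteg x) (g x) τ
  rw [setIntegral_underRoof hg hg₀ (hon hHτ fun _ => hM _),
    setIntegral_underRoof hg hg₀ (hon hH hM)]
  simp only [htranslate]
  rw [integral_add (integrable_intervalIntegral_underRoof hg hg₀ (hon hH hM)) hcoboundary,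
    integral_sub hJT hJ, integral_comp_of_measurePreserving hT hJ.aestronglyMeasurable, sub_self,
    add_zero]

end UnderRoof

section SuspensionMeasure

variable {m : ℕ} {ζ : Substitution m} {s : Fin m → ℝ} {μ : Measure (Space ζ)}

lemma measurable_roof (s : Fin m → ℝ) : Measurable fun x : Space ζ => s (x.1 0) :=
  (Measurable.of_discrete (f := s)).comp (measurable_coord 0)

lemma measurableSet_suspension (ζ : Substitution m) (s : Fin m → ℝ) :
    MeasurableSet (suspension ζ s) :=
  measurableSet_underRoof (measurable_roof s)

lemma integrable_roof [IsFiniteMeasure μ] (s : Fin m → ℝ) :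
    Integrable (fun x : Space ζ => s (x.1 0)) μ :=
  .of_bound (measurable_roof s).aestronglyMeasurable ‖s‖ (.of_forall fun _ => norm_le_pi_norm s _)

lemma prod_suspension_lt_top [IsFiniteMeasure μ] (s : Fin m → ℝ) :
    (μ.prod volume) (suspension ζ s) < ⊤ :=
  prod_underRoof_lt_top (measurable_roof s) (integrable_roof s)

lemma prod_suspension_ne_zero [NeZero μ] (hs : ∀ a, 0 < s a) :
    (μ.prod volume) (suspension ζ s) ≠ 0 := by
  change (μ.prod volume) (underRoof fun x : Space ζ => s (x.1 0)) ≠ 0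
  rw [prod_underRoof (measurable_roof s), Ne,
    lintegral_eq_zero_iff (measurable_roof s).ennreal_ofReal]
  intro hzero
  obtain ⟨x, hx⟩ := hzero.exists
  exact (ENNReal.ofReal_pos.2 (hs (x.1 0))).ne' hx

lemma suspMeasure₀_univ : suspMeasure₀ ζ s μ Set.univ = (μ.prod volume) (suspension ζ s) := by
  rw [suspMeasure₀,
    (MeasurableEmbedding.subtype_coe (measurableSet_suspension ζ s)).comap_apply, Set.image_univ,
    Subtype.range_coe]

lemma isProbabilityMeasure_suspMeasure [IsFiniteMeasure μ] [NeZero μ] (hs : ∀ a, 0 < s a) :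
    IsProbabilityMeasure (suspMeasure ζ s μ) := by
  refine ⟨?_⟩
  rw [suspMeasure, Measure.smul_apply, smul_eq_mul, suspMeasure₀_univ]
  exact ENNReal.inv_mul_cancel (prod_suspension_ne_zero hs) (prod_suspension_lt_top s).ne

lemma integral_suspMeasure {E : Type*} [NormedAddCommGroup E] [NormedSpace ℝ E]
    (F : Space ζ × ℝ → E) :
    ∫ y : suspension ζ s, F y.1 ∂(suspMeasure ζ s μ)
      = ((μ.prod volume) (suspension ζ s))⁻¹.toReal •
        ∫ p in suspension ζ s, F p ∂(μ.prod volume) := by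
  rw [suspMeasure, integral_smul_measure, suspMeasure₀_univ, suspMeasure₀,
    integral_subtype_comap (measurableSet_suspension ζ s) F]

lemma toSuspension_shift_one (hs : ∀ a, 0 < s a) (x : Space ζ) (u : ℝ) :
    toSuspension hs (shift ζ 1 x, u) = toSuspension hs (x, u + s (x.1 0)) := by
  rw [toSuspension_shift, ← zero_add (1 : ℤ), roofSum_succ, roofSum_zero, zero_add]

lemma measurePreserving_flow [IsFiniteMeasure μ] [NeZero μ] (hμ : MeasurePreserving (shift ζ 1) μ μ)
    (hs : ∀ a, 0 < s a) (τ : ℝ) :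
    MeasurePreserving (flow ζ hs τ) (suspMeasure ζ s μ) (suspMeasure ζ s μ) := by
  have := isProbabilityMeasure_suspMeasure (μ := μ) hs
  have hflow : Measurable (flow ζ hs τ) := (measurable_flow hs).of_uncurry_left
  refine ⟨hflow, Measure.ext fun A hA => ?_⟩
  rw [Measure.map_apply hflow hA, ← measureReal_eq_measureReal_iff]
  set H : Space ζ × ℝ → ℝ := fun p => A.indicator 1 (toSuspension hs p) with hH
  have hHmeas : Measurable H :=
    (measurable_one.indicator hA).comp (measurable_toSuspension hs)
  calc (suspMeasure ζ s μ).real (flow ζ hs τ ⁻¹' A)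
      = ∫ y, H (y.1.1, y.1.2 + τ) ∂(suspMeasure ζ s μ) := by
        rw [← integral_indicator_one (hflow hA)]
        rfl
    _ = ∫ y, H y.1 ∂(suspMeasure ζ s μ) := by
        rw [integral_suspMeasure H, integral_suspMeasure fun p => H (p.1, p.2 + τ)]
        congr 1
        refine setIntegral_underRoof_comp_add (M := 1) (measurable_roof s) (fun x => (hs _).le)
          (integrable_roof s) hμ hHmeas.stronglyMeasurable (fun p => ?_) (fun x u => ?_) τ
        · exact (norm_indicator_le_norm_self _ _).trans (by simp)
        · rw [hH]; simp only [toSuspension_shift_one]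
    _ = (suspMeasure ζ s μ).real A := by
        simp only [hH, toSuspension_coe]
        exact integral_indicator_one hA

lemma integral_letterIntegral_eq_zero [IsFiniteMeasure μ] [NeZero μ] (hs : ∀ a, 0 < s a)
    {ψ : Fin m → ℝ → ℂ} {M : ℝ} (hψ : ∀ a, Measurable (ψ a)) (hM : ∀ a t, ‖ψ a t‖ ≤ M)
    (hmean : ∫ y, cylindrical ζ s ψ y ∂(suspMeasure ζ s μ) = 0) :
    ∫ x : Space ζ, letterIntegral s ψ (x.1 0) ∂μ = 0 := by
  set F : Space ζ × ℝ → ℂ := fun p => ψ (p.1.1 0) p.2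
  have hF : Measurable F :=
    (measurable_from_prod_countable_right hψ : Measurable fun q : Fin m × ℝ => ψ q.1 q.2).comp
      (((measurable_coord 0).comp measurable_fst).prodMk measurable_snd)
  have hFint : IntegrableOn F (suspension ζ s) (μ.prod volume) :=
    Measure.integrableOn_of_bounded (prod_suspension_lt_top s).ne hF.aestronglyMeasurable
      (.of_forall fun p => hM _ _)
  have hscale : ((μ.prod volume) (suspension ζ s))⁻¹.toReal ≠ 0 :=
    (ENNReal.toReal_pos (ENNReal.inv_ne_zero.2 (prod_suspension_lt_top s).ne)
      (ENNReal.inv_ne_top.2 (prod_suspension_ne_zero hs))).ne'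
  refine (setIntegral_underRoof (measurable_roof s) (fun x => (hs _).le) hFint).symm.trans ?_
  exact (smul_eq_zero.1 ((integral_suspMeasure F).symm.trans hmean)).resolve_left hscale

end SuspensionMeasure

section SpectralMeasure

lemma norm_exp_two_pi_I_mul (ω t : ℝ) : ‖Complex.exp (2 * Real.pi * Complex.I * ω * t)‖ = 1 := by
  rw [show (2 * Real.pi * Complex.I * ω * t : ℂ) = (2 * Real.pi * ω * t : ℝ) * Complex.I by
    push_cast; ring, Complex.norm_exp_ofReal_mul_I]

lemma re_exp_two_pi_I_mul (ω t : ℝ) :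
    (Complex.exp (2 * Real.pi * Complex.I * ω * t)).re = Real.cos (2 * Real.pi * ω * t) := by
  rw [show (2 * Real.pi * Complex.I * ω * t : ℂ) = (2 * Real.pi * ω * t : ℝ) * Complex.I by
    push_cast; ring, Complex.exp_ofReal_mul_I_re]

lemma exp_two_pi_I_mul_mul_conj (ω t τ : ℝ) :
    Complex.exp (2 * Real.pi * Complex.I * ω * t)
        * (starRingEnd ℂ) (Complex.exp (2 * Real.pi * Complex.I * ω * τ))
      = Complex.exp (2 * Real.pi * Complex.I * ω * (t - τ : ℝ)) := by
  rw [← Complex.exp_conj, ← Complex.exp_add]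
  congr 1
  simp only [map_mul, Complex.conj_ofReal, Complex.conj_I, map_ofNat]
  push_cast
  ring

lemma measurable_exp_two_pi_I_mul :
    Measurable (Function.uncurry fun ω t : ℝ => Complex.exp (2 * Real.pi * Complex.I * ω * t)) := by
  simp only [Function.uncurry_def]
  fun_prop

lemma half_le_cos_of_abs_le_one {x : ℝ} (hx : |x| ≤ 1) : 1 / 2 ≤ Real.cos x := by
  have hsq : x ^ 2 ≤ 1 := (sq_le_one_iff_abs_le_one x).2 hx
  linarith [Real.one_sub_sq_div_two_le_cos (x := x)]

lemma half_le_norm_integral_exp {R ω : ℝ} (hR : 0 ≤ R) (hω : 2 * Real.pi * |ω| * R ≤ 1) :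
    R / 2 ≤ ‖∫ t in 0..R, Complex.exp (2 * Real.pi * Complex.I * ω * t)‖ := by
  have hexp : Continuous fun t : ℝ => Complex.exp (2 * Real.pi * Complex.I * ω * t) := by fun_prop
  have hcos : Continuous fun t : ℝ => Real.cos (2 * Real.pi * ω * t) := by fun_prop
  calc R / 2 = ∫ _ in 0..R, (1 / 2 : ℝ) := by simp; ring
    _ ≤ ∫ t in 0..R, Real.cos (2 * Real.pi * ω * t) := by
        refine intervalIntegral.integral_mono_on hR (by simp) (hcos.intervalIntegrable _ _)
          fun t ht => half_le_cos_of_abs_le_one ?_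
        rw [abs_mul, abs_mul, abs_of_pos Real.two_pi_pos, abs_of_nonneg ht.1]
        exact (by gcongr; exact ht.2 : _ ≤ 2 * Real.pi * |ω| * R).trans hω
    _ = (∫ t in 0..R, Complex.exp (2 * Real.pi * Complex.I * ω * t)).re := by
        simp only [← re_exp_two_pi_I_mul]
        exact intervalIntegral.intervalIntegral_re (𝕜 := ℂ) (hexp.intervalIntegrable 0 R)
    _ ≤ _ := Complex.re_le_norm _

lemma integral_norm_sq_integral {Y Z : Type*} [MeasurableSpace Y] [MeasurableSpace Z]
    (ν : Measure Y) [IsFiniteMeasure ν] (l : Measure Z) [IsFiniteMeasure l] {G : Y → Z → ℂ} {M : ℝ}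
    (hG : Measurable (Function.uncurry G)) (hM : ∀ y t, ‖G y t‖ ≤ M) :
    ((∫ y, ‖∫ t, G y t ∂l‖ ^ 2 ∂ν : ℝ) : ℂ)
      = ∫ p : Z × Z, ∫ y, G y p.1 * (starRingEnd ℂ) (G y p.2) ∂ν ∂(l.prod l) := by
  have hsq (y : Y) : ((‖∫ t, G y t ∂l‖ ^ 2 : ℝ) : ℂ)
      = ∫ p : Z × Z, G y p.1 * (starRingEnd ℂ) (G y p.2) ∂(l.prod l) := by
    rw [integral_prod_mul (fun t => G y t) (fun t => (starRingEnd ℂ) (G y t)), integral_conj,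
      Complex.mul_conj, Complex.normSq_eq_norm_sq]
  rw [← integral_complex_ofReal]
  simp only [hsq]
  refine integral_integral_swap (Integrable.of_bound (C := M * M) ?_ (.of_forall fun q => ?_))
  · have hfst : Measurable fun q : Y × (Z × Z) => G q.1 q.2.1 :=
      hG.comp (measurable_fst.prodMk (measurable_fst.comp measurable_snd))
    have hsnd : Measurable fun q : Y × (Z × Z) => G q.1 q.2.2 :=
      hG.comp (measurable_fst.prodMk (measurable_snd.comp measurable_snd))
    exact (hfst.mul (Complex.continuous_conj.measurable.comp hsnd)).aestronglyMeasurable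
  · rw [Function.uncurry, norm_mul, RCLike.norm_conj]
    exact mul_le_mul (hM _ _) (hM _ _) (norm_nonneg _) ((norm_nonneg _).trans (hM q.1 q.2.1))

lemma integrable_norm_sq_integral {Y Z : Type*} [MeasurableSpace Y] [MeasurableSpace Z]
    (ν : Measure Y) [IsFiniteMeasure ν] (l : Measure Z) [IsFiniteMeasure l] {G : Y → Z → ℂ} {M : ℝ}
    (hG : Measurable (Function.uncurry G)) (hM : ∀ y t, ‖G y t‖ ≤ M) :
    Integrable (fun y => ‖∫ t, G y t ∂l‖ ^ 2) ν := by
  have hmeas : Measurable fun y => ∫ t, G y t ∂l :=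
    (hG.stronglyMeasurable.integral_prod_right' (ν := l)).measurable
  refine .of_bound (hmeas.norm.pow_const 2).aestronglyMeasurable ((M * l.real Set.univ) ^ 2)
    (.of_forall fun y => ?_)
  rw [norm_pow, norm_norm]
  gcongr
  exact norm_integral_le_of_norm_le_const (.of_forall (hM y))

lemma measureReal_Icc_mul_sq_le_integral_norm_sq (σ : Measure ℝ) [IsFiniteMeasure σ] {r R : ℝ}
    (hR : 0 ≤ R) (hrR : 2 * Real.pi * r * R ≤ 1) :
    σ.real (Set.Icc (-r) r) * (R / 2) ^ 2
      ≤ ∫ ω : ℝ, ‖∫ t : ℝ in 0..R, Complex.exp (2 * Real.pi * Complex.I * ω * t)‖ ^ 2 ∂σ := by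
  have hinteg : Integrable
      (fun ω : ℝ => ‖∫ t : ℝ in 0..R, Complex.exp (2 * Real.pi * Complex.I * ω * t)‖ ^ 2) σ := by
    simp only [intervalIntegral.integral_of_le hR]
    exact integrable_norm_sq_integral σ _ measurable_exp_two_pi_I_mul
      fun ω t => (norm_exp_two_pi_I_mul ω t).le
  calc σ.real (Set.Icc (-r) r) * (R / 2) ^ 2 = ∫ _ in Set.Icc (-r) r, (R / 2) ^ 2 ∂σ := by
        rw [setIntegral_const, smul_eq_mul]
    _ ≤ ∫ ω in Set.Icc (-r) r,
          ‖∫ t : ℝ in 0..R, Complex.exp (2 * Real.pi * Complex.I * ω * t)‖ ^ 2 ∂σ := by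
        refine setIntegral_mono_on (integrable_const _).integrableOn hinteg.integrableOn
          measurableSet_Icc fun ω hω => ?_
        gcongr
        refine half_le_norm_integral_exp hR (le_trans ?_ hrR)
        gcongr
        exact abs_le.2 hω
    _ ≤ ∫ ω : ℝ, ‖∫ t : ℝ in 0..R, Complex.exp (2 * Real.pi * Complex.I * ω * t)‖ ^ 2 ∂σ :=
        setIntegral_le_integral hinteg (.of_forall fun ω => by positivity)

namespace IsSpectralMeasure

variable {Y : Type*} [MeasurableSpace Y] {ν : Measure Y} {h : ℝ → Y → Y} {f : Y → ℂ} {σ : Measure ℝ}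

lemma integral_exp_mul_conj_exp (hσ : IsSpectralMeasure ν h f σ)
    (hadd : ∀ t τ y, h (t + τ) y = h t (h τ y)) (hν : ∀ t, MeasurePreserving (h t) ν ν)
    (hf : Measurable f) (t τ : ℝ) :
    ∫ ω : ℝ, Complex.exp (2 * Real.pi * Complex.I * ω * t)
        * (starRingEnd ℂ) (Complex.exp (2 * Real.pi * Complex.I * ω * τ)) ∂σ
      = ∫ y, f (h t y) * (starRingEnd ℂ) (f (h τ y)) ∂ν := by
  have hcorr : Measurable fun y => f (h (t - τ) y) * (starRingEnd ℂ) (f y) :=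
    (hf.comp (hν (t - τ)).measurable).mul (Complex.continuous_conj.measurable.comp hf)
  simp only [exp_two_pi_I_mul_mul_conj]
  rw [hσ.2, ← integral_comp_of_measurePreserving (hν τ) hcorr.aestronglyMeasurable]
  simp only [← hadd, sub_add_cancel]

lemma integral_norm_sq_integral_exp [IsFiniteMeasure ν] (hσ : IsSpectralMeasure ν h f σ)
    (hmeas : Measurable fun p : ℝ × Y => h p.1 p.2) (hadd : ∀ t τ y, h (t + τ) y = h t (h τ y))
    (hν : ∀ t, MeasurePreserving (h t) ν ν) (hf : Measurable f) {M : ℝ} (hM : ∀ y, ‖f y‖ ≤ M)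
    (l : Measure ℝ) [IsFiniteMeasure l] :
    ∫ ω : ℝ, ‖∫ t : ℝ, Complex.exp (2 * Real.pi * Complex.I * ω * t) ∂l‖ ^ 2 ∂σ
      = ∫ y, ‖∫ t, f (h t y) ∂l‖ ^ 2 ∂ν := by
  have := hσ.1
  have horbit : Measurable (Function.uncurry fun y t => f (h t y)) :=
    hf.comp (hmeas.comp measurable_swap)
  refine Complex.ofReal_injective ?_
  rw [integral_norm_sq_integral σ l measurable_exp_two_pi_I_mul
      fun ω t => (norm_exp_two_pi_I_mul ω t).le,
    integral_norm_sq_integral ν l horbit fun y t => hM _]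
  simp only [hσ.integral_exp_mul_conj_exp hadd hν hf]

lemma measureReal_Icc_mul_sq_le [IsProbabilityMeasure ν] (hσ : IsSpectralMeasure ν h f σ)
    (hmeas : Measurable fun p : ℝ × Y => h p.1 p.2) (hadd : ∀ t τ y, h (t + τ) y = h t (h τ y))
    (hν : ∀ t, MeasurePreserving (h t) ν ν) (hf : Measurable f) {M : ℝ} (hM : ∀ y, ‖f y‖ ≤ M)
    {r R b : ℝ} (hR : 0 ≤ R) (hrR : 2 * Real.pi * r * R ≤ 1)
    (hb : ∀ y, ‖∫ t in 0..R, f (h t y)‖ ≤ b) :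
    σ.real (Set.Icc (-r) r) * (R / 2) ^ 2 ≤ b ^ 2 := by
  have := hσ.1
  calc σ.real (Set.Icc (-r) r) * (R / 2) ^ 2
      ≤ ∫ ω : ℝ, ‖∫ t : ℝ in 0..R, Complex.exp (2 * Real.pi * Complex.I * ω * t)‖ ^ 2 ∂σ :=
        measureReal_Icc_mul_sq_le_integral_norm_sq σ hR hrR
    _ = ∫ y, ‖∫ t in 0..R, f (h t y)‖ ^ 2 ∂ν := by
        simp only [intervalIntegral.integral_of_le hR]
        exact hσ.integral_norm_sq_integral_exp hmeas hadd hν hf hM _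
    _ ≤ ‖∫ y, ‖∫ t in 0..R, f (h t y)‖ ^ 2 ∂ν‖ := le_abs_self _
    _ ≤ b ^ 2 * ν.real Set.univ := norm_integral_le_of_norm_le_const <| .of_forall fun y => by
        rw [norm_pow, norm_norm]
        gcongr
        exact hb y
    _ = b ^ 2 := by rw [probReal_univ, mul_one]

end IsSpectralMeasure

end SpectralMeasure

section MainEstimate

variable {m : ℕ} {ζ : Substitution m} {s : Fin m → ℝ} {μ : Measure (Space ζ)}

lemma norm_letterIntegral_le {ψ : Fin m → ℝ → ℂ} {M : ℝ} (hM₀ : 0 ≤ M)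
    (hM : ∀ a t, ‖ψ a t‖ ≤ M) : ‖letterIntegral s ψ‖ ≤ M * ‖s‖ := by
  refine (pi_norm_le_iff_of_nonneg (by positivity)).2 fun a => ?_
  refine (intervalIntegral.norm_integral_le_of_norm_le_const fun t _ => hM a t).trans ?_
  rw [sub_zero]
  gcongr
  exact norm_le_pi_norm s a

lemma one_add_log_mul_le {D X : ℝ} (hD : 1 ≤ D) (hX : 1 ≤ X) :
    1 + Real.log (D * X) ≤ (1 + Real.log D) * (1 + Real.log X) := by
  rw [Real.log_mul (by linarith) (by linarith)]
  nlinarith [mul_nonneg (Real.log_nonneg hD) (Real.log_nonneg hX)]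

lemma mul_log_pow_mul_rpow_add_le {A B D X β : ℝ} (hA : 0 ≤ A) (hB : 0 ≤ B) (hD : 1 ≤ D)
    (hX : 1 ≤ X) (hβ : 0 ≤ β) (α : ℕ) :
    A * (1 + Real.log (D * X)) ^ α * (D * X) ^ β + B
      ≤ (A * (1 + Real.log D) ^ α * D ^ β + B) * ((1 + Real.log X) ^ α * X ^ β) := by
  have hlogX := Real.log_nonneg hX
  have hlogDX := Real.log_nonneg (one_le_mul_of_one_le_of_one_le hD hX)
  have hone : 1 ≤ (1 + Real.log X) ^ α * X ^ β :=
    one_le_mul_of_one_le_of_one_le (one_le_pow₀ (by linarith)) (Real.one_le_rpow hX hβ)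
  calc A * (1 + Real.log (D * X)) ^ α * (D * X) ^ β + B
      ≤ A * ((1 + Real.log D) * (1 + Real.log X)) ^ α * (D ^ β * X ^ β)
          + B * ((1 + Real.log X) ^ α * X ^ β) := by
        rw [Real.mul_rpow (by linarith) (by linarith)]
        gcongr
        · exact one_add_log_mul_le hD hX
        · exact le_mul_of_one_le_right hB hone
    _ = _ := by rw [mul_pow]; ring

lemma exists_norm_integral_cylindrical_flow_le [IsProbabilityMeasure μ]
    (hμ : MeasurePreserving (shift ζ 1) μ μ) (hζ : ζ.IsPrimitive) {θ₁ θ₂ : ℂ} {rest : List ℂ}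
    (hθ : ζ.IsEigenvalueList (θ₁ :: θ₂ :: rest)) (hθ₂ : 1 < ‖θ₂‖) {α : ℕ}
    (hα : (θ₁ :: θ₂ :: rest).countP (fun z => ‖z‖ = ‖θ₂‖) = α + 1) (hs : ∀ a, 0 < s a) :
    ∃ K, 0 ≤ K ∧ ∀ ψ : Fin m → ℝ → ℂ, (∀ a, Measurable (ψ a)) →
      ∫ y, cylindrical ζ s ψ y ∂(suspMeasure ζ s μ) = 0 → ∀ M, (∀ a t, ‖ψ a t‖ ≤ M) →
      ∀ (y : suspension ζ s) (T : ℝ), 0 ≤ T →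
        ‖∫ t in 0..T, cylindrical ζ s ψ (flow ζ hs t y)‖
          ≤ K * M * ((1 + Real.log (1 + T)) ^ α * (1 + T) ^ Real.logb ‖θ₁‖ ‖θ₂‖) := by
  have : Nonempty (Fin m) := μ.nonempty_of_neZero.map fun x => x.1 0
  obtain ⟨a₀, hc⟩ := Finite.exists_min s
  obtain ⟨K, hK₀, hK⟩ := exists_norm_sum_map_le_of_integral_coord_eq_zero hμ hζ hθ hθ₂ hα
  have hS (a : Fin m) : s a ≤ ‖s‖ := (le_abs_self _).trans (norm_le_pi_norm s a)
  have hβ : 0 ≤ Real.logb ‖θ₁‖ ‖θ₂‖ :=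
    Real.logb_nonneg (hθ₂.trans_le (List.rel_of_pairwise_cons hθ.2 (by simp))) hθ₂.le
  set D := (1 + ‖s‖) / s a₀
  have hD : 1 ≤ D := (one_le_div (hs a₀)).2 (by linarith [hS a₀])
  have hlogD := Real.log_nonneg hD
  refine ⟨K * ‖s‖ * (1 + Real.log D) ^ α * D ^ Real.logb ‖θ₁‖ ‖θ₂‖ + 2 * ‖s‖, by positivity,
    fun ψ hψ hmean M hM y T hT => ?_⟩
  have hT₁ : 1 ≤ 1 + T := le_add_of_nonneg_right hT
  have hDT : 1 ≤ D * (1 + T) := one_le_mul_of_one_le_of_one_le hD hT₁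
  have hM₀ : 0 ≤ M := (norm_nonneg _).trans (hM a₀ 0)
  obtain ⟨w, hw, hlen, hsum⟩ :=
    exists_norm_integral_orbitFun_le hs (hs a₀) hc hS hψ hM y.1.1 y.1.2 hT
  have hlenD : (w.length : ℝ) ≤ D * (1 + T) := hlen.trans <| by
    rw [div_mul_eq_mul_div]
    exact div_le_div_of_nonneg_right (by nlinarith [norm_nonneg s]) (hs a₀).le
  have hword := hK _ (integral_letterIntegral_eq_zero hs hψ hM hmean) w hw _ hDT hlenD
  have hlog := Real.log_nonneg hDT
  simp only [cylindrical_flow]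
  rw [intervalIntegral.integral_comp_add_left (orbitFun hs ψ y.1.1), add_zero]
  refine ((hsum.trans (add_le_add_left (hword.trans ?_) _)).trans
    (mul_log_pow_mul_rpow_add_le (A := K * (M * ‖s‖)) (by positivity) (by positivity) hD hT₁ hβ
      α)).trans_eq (by ring)
  gcongr
  exact norm_letterIntegral_le hM₀ hM

lemma one_add_one_div_two_pi_mul_le {r : ℝ} (hr : 0 < r) (hr₂ : r ≤ 1 / 2) :
    1 + 1 / (2 * Real.pi * r) ≤ 1 / r := by
  have hpi : 1 / (2 * Real.pi) ≤ 1 / 2 :=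
    one_div_le_one_div_of_le two_pos (by linarith [Real.pi_gt_three])
  rw [le_div_iff₀ hr, add_mul, ← div_div, div_mul_cancel₀ _ hr.ne']
  linarith

lemma one_add_log_one_div_le {r : ℝ} (hr : 0 < r) (hr₂ : r ≤ 1 / 2) :
    1 + Real.log (1 / r) ≤ 3 * Real.log (1 / r) := by
  have hlog : Real.log 2 ≤ Real.log (1 / r) :=
    Real.log_le_log two_pos (by rw [le_div_iff₀ hr]; linarith)
  linarith [Real.log_two_gt_d9]

lemma measureReal_Icc_le_of_norm_integral_le {Y : Type*} [MeasurableSpace Y] {ν : Measure Y}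
    [IsProbabilityMeasure ν] {h : ℝ → Y → Y} {f : Y → ℂ} {σ : Measure ℝ}
    (hσ : IsSpectralMeasure ν h f σ) (hmeas : Measurable fun p : ℝ × Y => h p.1 p.2)
    (hadd : ∀ t τ y, h (t + τ) y = h t (h τ y)) (hν : ∀ t, MeasurePreserving (h t) ν ν)
    (hf : Measurable f) {M : ℝ} (hM : ∀ y, ‖f y‖ ≤ M) {B β : ℝ} {α : ℕ} (hB : 0 ≤ B) (hβ : 0 ≤ β)
    (hgrowth : ∀ y T, 0 ≤ T →
      ‖∫ t in 0..T, f (h t y)‖ ≤ B * ((1 + Real.log (1 + T)) ^ α * (1 + T) ^ β))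
    {r : ℝ} (hr : 0 < r) (hr₂ : r ≤ 1 / 2) :
    σ.real (Set.Icc (-r) r)
      ≤ 16 * Real.pi ^ 2 * 3 ^ (2 * α) * B ^ 2 * Real.log (1 / r) ^ (2 * α) * r ^ (2 - 2 * β) := by
  set R := 1 / (2 * Real.pi * r) with hR
  have hR₀ : 0 < R := by positivity
  have hlogR := Real.log_nonneg (le_add_of_nonneg_right hR₀.le : 1 ≤ 1 + R)
  have hRr := one_add_one_div_two_pi_mul_le hr hr₂
  have hbound (y : Y) :
      ‖∫ t in 0..R, f (h t y)‖ ≤ B * ((3 * Real.log (1 / r)) ^ α * (1 / r) ^ β) := by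
    have hlog : 1 + Real.log (1 + R) ≤ 3 * Real.log (1 / r) :=
      calc 1 + Real.log (1 + R) ≤ 1 + Real.log (1 / r) := by gcongr
        _ ≤ 3 * Real.log (1 / r) := one_add_log_one_div_le hr hr₂
    have hlog₀ : 0 ≤ 3 * Real.log (1 / r) := le_trans (by linarith) hlog
    refine (hgrowth y R hR₀.le).trans ?_
    gcongr
  have hmass := hσ.measureReal_Icc_mul_sq_le hmeas hadd hν hf hM (r := r) hR₀.le
    (mul_one_div_cancel (by positivity)).le hbound
  have hrpow : r ^ (2 - 2 * β) = r ^ 2 * ((1 / r) ^ β) ^ 2 := by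
    rw [Real.rpow_sub hr, mul_comm 2 β, Real.rpow_mul hr.le, one_div, Real.inv_rpow hr.le]
    norm_cast
    rw [inv_pow, div_eq_mul_inv]
  have hR_sq : (R / 2) ^ 2 = (16 * Real.pi ^ 2 * r ^ 2)⁻¹ := by
    rw [hR]; field_simp; norm_num
  rw [hR_sq, ← div_eq_mul_inv, div_le_iff₀ (by positivity)] at hmass
  refine hmass.trans_eq ?_
  rw [hrpow]
  ring

lemma measurable_indicator_of_continuousOn {X E : Type*} [TopologicalSpace X]
    [MeasurableSpace X] [OpensMeasurableSpace X] [TopologicalSpace E] [MeasurableSpace E]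
    [BorelSpace E] [Zero E] {f : X → E} {t : Set X} (ht : MeasurableSet t)
    (hf : ContinuousOn f t) : Measurable (t.indicator f) := by
  classical
  rw [← Set.piecewise_eq_indicator]
  exact hf.measurable_piecewise continuousOn_const ht

end MainEstimate

end SubstFlow

theorem mainTheorem5_general {m : ℕ} (ζ : SubstFlow.Substitution m) (hζ : ζ.IsPrimitive)
    (θ₁ θ₂ : ℂ) (rest : List ℂ) (hθ : ζ.IsEigenvalueList (θ₁ :: θ₂ :: rest))
    (hθ₂ : 1 < ‖θ₂‖)
    (α : ℕ) (hα : (θ₁ :: θ₂ :: rest).countP (fun z => ‖z‖ = ‖θ₂‖) = α + 1)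
    (μ : Measure (SubstFlow.Space ζ)) [IsProbabilityMeasure μ]
    (hμ : MeasurePreserving (SubstFlow.shift ζ 1) μ μ)
    (s : Fin m → ℝ) (hs : ∀ a, 0 < s a) :
    ∃ C : ℝ, ∀ ψ : Fin m → ℝ → ℂ,
      (∀ a, Measurable ((Set.Ico 0 (s a)).indicator (ψ a))) →
      ∫ y, SubstFlow.cylindrical ζ s ψ y ∂(SubstFlow.suspMeasure ζ s μ) = 0 →
      ∀ M : ℝ, (∀ a, ∀ t ∈ Set.Ico 0 (s a), ‖ψ a t‖ ≤ M) →
      ∀ σ : Measure ℝ,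
        SubstFlow.IsSpectralMeasure (SubstFlow.suspMeasure ζ s μ) (SubstFlow.flow ζ hs)
          (SubstFlow.cylindrical ζ s ψ) σ →
        ∀ r : ℝ, 0 < r → r ≤ 1 / 2 →
          σ.real (Set.Icc (-r) r) ≤
            C * M ^ 2 * Real.log (1 / r) ^ (2 * α) * r ^ (2 - 2 * Real.logb ‖θ₁‖ ‖θ₂‖) := by
  obtain ⟨K, hK, hgrowth⟩ :=
    SubstFlow.exists_norm_integral_cylindrical_flow_le hμ hζ hθ hθ₂ hα hs
  refine ⟨16 * Real.pi ^ 2 * 3 ^ (2 * α) * K ^ 2, fun ψ hψ hmean M hM σ hσ r hr hr₂ => ?_⟩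
  set φ : Fin m → ℝ → ℂ := fun a => (Set.Ico 0 (s a)).indicator (ψ a)
  have hφ : SubstFlow.cylindrical ζ s ψ = SubstFlow.cylindrical ζ s φ :=
    funext fun y => (Set.indicator_of_mem (s := Set.Ico 0 (s (y.1.1.1 0))) y.2 (ψ _)).symm
  rw [hφ] at hmean hσ
  obtain ⟨x⟩ := μ.nonempty_of_neZero
  have hM₀ : 0 ≤ M := (norm_nonneg _).trans (hM (x.1 0) 0 ⟨le_rfl, hs _⟩)
  have hφM (a : Fin m) (t : ℝ) : ‖φ a t‖ ≤ M :=
    (norm_indicator_eq_indicator_norm _ _).trans_le (Set.indicator_le' (hM a) (fun _ _ => hM₀) t)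
  have := SubstFlow.isProbabilityMeasure_suspMeasure (ζ := ζ) (μ := μ) hs
  have hβ : 0 ≤ Real.logb ‖θ₁‖ ‖θ₂‖ :=
    Real.logb_nonneg (hθ₂.trans_le (List.rel_of_pairwise_cons hθ.2 (by simp))) hθ₂.le
  refine (SubstFlow.measureReal_Icc_le_of_norm_integral_le hσ (SubstFlow.measurable_flow hs)
    (SubstFlow.flow_add hs) (SubstFlow.measurePreserving_flow hμ hs)
    (SubstFlow.measurable_cylindrical hψ) (fun y => hφM _ _) (mul_nonneg hK hM₀) hβ
    (hgrowth φ hψ hmean M hφM) hr hr₂).trans_eq (by ring)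

theorem mainTheorem5 {m : ℕ} (ζ : SubstFlow.Substitution m) (hζ : ζ.IsPrimitive)
    (θ₁ θ₂ : ℂ) (rest : List ℂ) (hθ : ζ.IsEigenvalueList (θ₁ :: θ₂ :: rest))
    (hθ₂ : 1 < ‖θ₂‖)
    (α : ℕ) (hα : (θ₁ :: θ₂ :: rest).countP (fun z => ‖z‖ = ‖θ₂‖) = α + 1)
    (μ : MeasureTheory.Measure (SubstFlow.Space ζ)) [MeasureTheory.IsProbabilityMeasure μ]
    (hμ : MeasureTheory.MeasurePreserving (SubstFlow.shift ζ 1) μ μ)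
    (s : Fin m → ℝ) (hs : s ∈ SubstFlow.roofSimplex m) :
    ∃ C : ℝ, ∀ ψ : Fin m → ℝ → ℂ,
      (∀ a, ∃ K, LipschitzOnWith K (ψ a) (Set.Icc 0 (s a))) →
      ∫ y, SubstFlow.cylindrical ζ s ψ y ∂(SubstFlow.suspMeasure ζ s μ) = 0 →
      ∀ M : ℝ, (∀ a, ∀ t ∈ Set.Icc 0 (s a), ‖ψ a t‖ ≤ M) →
      ∀ σ : MeasureTheory.Measure ℝ,
        SubstFlow.IsSpectralMeasure (SubstFlow.suspMeasure ζ s μ) (SubstFlow.flow ζ hs.1)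
          (SubstFlow.cylindrical ζ s ψ) σ →
        ∀ r : ℝ, 0 < r → r ≤ 1 / 2 →
          σ.real (Set.Icc (-r) r) ≤
            C * M ^ 2 * Real.log (1 / r) ^ (2 * α) * r ^ (2 - 2 * Real.logb ‖θ₁‖ ‖θ₂‖) := by
  obtain ⟨C, hC⟩ := mainTheorem5_general ζ hζ θ₁ θ₂ rest hθ hθ₂ α hα μ hμ s hs.1
  exact ⟨C, fun ψ hψ hmean M hM => hC ψ
    (fun a => SubstFlow.measurable_indicator_of_continuousOn measurableSet_Ico
      ((hψ a).choose_spec.continuousOn.mono Set.Ico_subset_Icc_self)) hmean M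
    fun a t ht => hM a t (Set.Ico_subset_Icc_self ht)⟩
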